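/- **Setting.** Let $d\ge 1$. All path spaces $C^0([0,t],\mathbb R^d)$ carry the uniform topology and its Borel $\sigma$-algebra, $\mathcal P(\cdot)$ denotes Borel probability measures, and $\pi^t:C^0([0,1],\mathbb R^d)\to C^0([0,t],\mathbb R^d)$ is the restriction map. Let $\mathcal V$ be the set of velocity fields $u\in C^\infty_{\rm loc}((0,1]\times\mathbb R^d;\mathbb R^d)\cap L^1([0,1],C^0(\mathbb R^d))$, i.e. $u$ is smooth on $(0,1]\times\mathbb R^d$ and $\int_0^1\sup_x|u(t,x)|\,dt<\infty$, with the $\sigma$-algebra generated by the evaluations $u\mapsto u(t,x)$, $(t,x)\in(0,1]\times\mathbb R^d$ (the Borel $\sigma$-algebra inherited from $C^\infty_{\rm loc}$). For $u\in\mathcal V$, $y\in\mathbb R^d$ consider $$dX_t=u(t,X_t)\,dt+dW_t,\qquad X_0=y. \tag{1}$$ * For a deterministic $W\in C^0([0,1],\mathbb R^d)$, a *Carathéodory solution* of (1) is $X\in C^0([0,1],\mathbb R^d)$ with $X_t=y+\int_0^tu(s,X_s)\,ds+W_t-W_0$ for all $t\in[0,1]$. For $s\in(0,1]$ and $x\in\mathbb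 R^d$, $t\mapsto X^{s,x,u,W}_t$, $t\in[s,1]$, is the unique solution of $X_t=x+\int_s^tu(r,X_r)\,dr+W_t-W_s$. * A *weak solution* of (1) with driving noise $\mathbb W\in\mathcal P(C^0([0,1],\mathbb R^d))$ is $\mathbb X(dX,dW)\in\mathcal P(C^0([0,1],\mathbb R^d)^2)$ such that (i) its $W$-marginal is $\mathbb W$; (ii) for every $t\in[0,1]$, under $\mathbb X$, $\pi^tX$ and $W$ are conditionally independent given $\pi^tW$; (iii) $\mathbb X$-a.s., $X$ is a Carathéodory solution of (1) for the noise path $W$. *Weak uniqueness* means that any two weak solutions are equal. * A *coupling of two weak solutions* is a probability measure $\mathbb Y(dX^1,dX^2,dW)$ on $C^0([0,1],\mathbb R^d)^3$ whose marginals in $(X^1,W)$ and in $(X^2,W)$ are both weak solutions of (1). *Pathwise uniqueness* means that $X^1=X^2$ $\mathbb Y$-a.s. for every such $\mathbb Y$; *pathwise nonuniqueness* is its failure. * $\mathbb W$ is a *regular driving noise* if for every $t\in[0,1]$ the conditional law of $W$ given $\pi^tW$ has a representative $w\mapsto\mathbb W(d\tilde W\mid w)$, $w\in C^0([0,t],\mathbb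 R^d)$, that is continuous for the weak topology on probability measures. * For times $T^n\in(0,1]$ with $T^n\to0$, a law $\mathbb U\in\mathcal P(\mathcal V)$ is *explosively separating* for $(T^n)$ and $W\in C^0([0,1],\mathbb R^d)$ if $$\lim_{n\to\infty}\limsup_{\delta\to0^+}\ \limsup_{|x-z|\to0,\ x\neq z}\ \limsup_{m\to\infty}\ \mathbb U\big(|X^{T^m,x,u,W}_{T^n}-X^{T^m,z,u,W}_{T^n}|<\delta\big)=0 .$$ **Theorem.** Let $\mathbb W$ be a regular driving noise, let $\mathbb U\in\mathcal P(\mathcal V)$ be the law of a random velocity field independent of the noise, and let $T^n\in(0,1]$, $T^n\to0$, be such that $\mathbb U$ is explosively separating for $(T^n)$ and $\mathbb W$-almost every $W$. Then for every $y\in\mathbb R^d$ and for $\mathbb U$-almost every $u$, equation (1) with driving noise $\mathbb W$ exhibits pathwise nonuniqueness, and moreover: 1. for every $\varepsilon\in(0,1]$ and $\gamma>0$ there is a coupling $\mathbb Y$ of two weak solutions of (1) with $\mathbb Y(X^1|_{[0,\varepsilon]}=X^2|_{[0,\varepsilon]})\le\gamma$; 2. there is a weak solution $\mathbb X(dX,dW)$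 of (1) such that for every $\varepsilon\in(0,1]$, for $\mathbb W$-almost every $W$, the conditional law $\pi^\varepsilon_*\mathbb X(d\tilde X\mid W)$ of $X|_{[0,\varepsilon]}$ given $W$ has more than one path in its support; 3. if weak uniqueness holds for (1), then for every $\varepsilon\in(0,1]$ there is a coupling $\mathbb Y$ of two weak solutions of (1) with $\mathbb Y(X^1|_{[0,\varepsilon]}=X^2|_{[0,\varepsilon]})=0$. Also, for every $y\in\mathbb R^d$ and for $\mathbb U\otimes\mathbb W$-almost every $(u,W)$: for every $\varepsilon\in(0,1]$, equation (1) has two Carathéodory solutions on $[0,1]$ that do not coincide on $[0,\varepsilon]$. -/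

import Mathlib

open MeasureTheory ProbabilityTheory Filter Topology
open scoped unitInterval ENNReal ContDiff

noncomputable section

namespace AdditiveSDE

/-- The state space `ℝᵈ` with its Euclidean norm. -/
abbrev Space (d : ℕ) : Type := EuclideanSpace ℝ (Fin d)

/-- The path space `C⁰([0,1], ℝᵈ)` with the topology of uniform convergence. -/
abbrev PathSpace (d : ℕ) : Type := C(I, Space d)

/-- The path space `C⁰([0,t], ℝᵈ)` for `t ∈ [0,1]`; here `Set.Iic t` is `[0,t]` as a subset
of `[0,1]`. -/
abbrev PathSpaceUpTo (d : ℕ) (t : I) : Type := C(Set.Iic t, Space d)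

/-- Spaces of continuous functions carry their Borel `σ`-algebra. -/
instance instMeasurableSpacePaths {X : Type*} [TopologicalSpace X] (d : ℕ) :
    MeasurableSpace C(X, Space d) := borel _

instance instBorelSpacePaths {X : Type*} [TopologicalSpace X] (d : ℕ) :
    BorelSpace C(X, Space d) := ⟨rfl⟩

/-- The restriction map `π^t : C⁰([0,1], ℝᵈ) → C⁰([0,t], ℝᵈ)`. -/
def restr {d : ℕ} (t : I) (X : PathSpace d) : PathSpaceUpTo d t :=
  X.restrict (Set.Iic t)

theorem continuous_restr {d : ℕ} (t : I) : Continuous (restr (d := d) t) :=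
  ContinuousMap.continuous_restrict _

theorem measurable_restr {d : ℕ} (t : I) : Measurable (restr (d := d) t) :=
  (continuous_restr t).measurable

/-- The value of a path at a real time (only used for times in `[0,1]`). -/
def at_ {d : ℕ} (X : PathSpace d) (r : ℝ) : Space d :=
  X (Set.projIcc 0 1 zero_le_one r)

/-- A velocity field in `C^∞_loc((0,1] × ℝᵈ) ∩ L¹([0,1], C⁰(ℝᵈ))`: smooth on `(0,1] × ℝᵈ` (up to
and including the time `1`) with `∫₀¹ sup_x |u(t,x)| dt < ∞`. Since only the values at times in
`(0,1]` are meaningful, the field is normalized to vanish at all other times. -/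
structure VelocityField (d : ℕ) where
  toFun : ℝ → Space d → Space d
  smooth : ContDiffOn ℝ ∞ (fun p : ℝ × Space d => toFun p.1 p.2)
    (Set.Ioc (0 : ℝ) 1 ×ˢ (Set.univ : Set (Space d)))
  integrable : ∫⁻ t in Set.Ioc (0 : ℝ) 1, ⨆ x : Space d, ‖toFun t x‖ₑ < ⊤
  eq_zero : ∀ t, t ∉ Set.Ioc (0 : ℝ) 1 → toFun t = 0

instance instCoeFunVelocityField (d : ℕ) :
    CoeFun (VelocityField d) (fun _ => ℝ → Space d → Space d) := ⟨VelocityField.toFun⟩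

/-- The `σ`-algebra on velocity fields generated by the point evaluations `u ↦ u(t,x)`. It is the
trace of the Borel `σ`-algebra of the Polish space `C^∞_loc((0,1] × ℝᵈ)`. -/
instance instMeasurableSpaceVelocityField (d : ℕ) : MeasurableSpace (VelocityField d) :=
  MeasurableSpace.comap VelocityField.toFun MeasurableSpace.pi

/-- `X` is a Carathéodory solution on `[0,1]` of `dX = u(t,X) dt + dW`, `X₀ = y`. -/
def IsCaratheodorySolution {d : ℕ} (u : VelocityField d) (y : Space d) (W X : PathSpace d) :
    Prop :=
  ∀ t : I, X t = y + (∫ r in (0 : ℝ)..t, u r (at_ X r)) + W t - W 0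

/-- `X` solves `dX = u(t,X) dt + dW` on `[s,1]` with `X_s = x`; before the time `s` the path is
extended by the constant `x`. -/
def IsSolutionFrom {d : ℕ} (u : VelocityField d) (s : I) (x : Space d) (W X : PathSpace d) :
    Prop :=
  (∀ t : I, t ≤ s → X t = x) ∧
    ∀ t : I, s ≤ t → X t = x + (∫ r in (s : ℝ)..t, u r (at_ X r)) + W t - W s

open Classical in
/-- The path `t ↦ X^{s,x,u,W}_t`, i.e. the solution started from `x` at the time `s > 0`, which
exists and is unique because `u` is smooth at positive times and `∫₀¹ sup_x |u(t,x)| dt < ∞`. -/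
def flow {d : ℕ} (s : I) (x : Space d) (u : VelocityField d) (W : PathSpace d) : PathSpace d :=
  if h : ∃ X : PathSpace d, IsSolutionFrom u s x W X then h.choose else 0

/-- The random velocity field with law `𝕌` is explosively separating for the times `T n` and the
noise path `W`. The filter `comap dist (𝓝[>] 0)` on pairs of points expresses `|x - y| → 0` along
pairs of distinct points. -/
def ExplosivelySeparating {d : ℕ} (𝕌 : ProbabilityMeasure (VelocityField d)) (T : ℕ → I)
    (W : PathSpace d) : Prop :=
  Tendsto
    (fun n : ℕ =>
      limsup (fun δ : ℝ =>
        limsup (fun p : Space d × Space d =>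
          limsup (fun m : ℕ =>
            (𝕌 : Measure (VelocityField d))
              {u | dist (flow (T m) p.1 u W (T n)) (flow (T m) p.2 u W (T n)) < δ})
            atTop)
          (comap (fun p : Space d × Space d => dist p.1 p.2) (𝓝[>] 0)))
        (𝓝[>] 0))
    atTop (𝓝 (0 : ℝ≥0∞))

/-- The noise law `𝕎` is regular: for every `t`, the conditional law of `W` given `π^t W` has a
representative which is continuous for the weak topology on probability measures. -/
def IsRegularNoise {d : ℕ} (𝕎 : ProbabilityMeasure (PathSpace d)) : Prop :=
  ∀ t : I, ∃ κ : PathSpaceUpTo d t → ProbabilityMeasure (PathSpace d), Continuous κ ∧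
    ∀ᵐ w ∂((𝕎 : Measure (PathSpace d)).map (restr t)),
      condDistrib (fun W : PathSpace d => W) (restr t) (𝕎 : Measure (PathSpace d)) w = κ w

/-- Weak solutions: joint laws `𝕏(dX, dW)` of a solution and the noise. -/
structure IsWeakSolution {d : ℕ} (u : VelocityField d) (y : Space d)
    (𝕎 : ProbabilityMeasure (PathSpace d))
    (𝕏 : ProbabilityMeasure (PathSpace d × PathSpace d)) : Prop where
  /-- The marginal law of the noise is `𝕎`. -/
  marginal : (𝕏 : Measure (PathSpace d × PathSpace d)).map Prod.snd = 𝕎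
  /-- `π^t X` and `W` are conditionally independent given `π^t W`. -/
  nonanticipating : ∀ t : I,
    CondIndepFun
      (MeasurableSpace.comap (fun p : PathSpace d × PathSpace d => restr t p.2) inferInstance)
      ((measurable_restr t).comp measurable_snd).comap_le
      (fun p : PathSpace d × PathSpace d => restr t p.1)
      (fun p : PathSpace d × PathSpace d => p.2)
      (𝕏 : Measure (PathSpace d × PathSpace d))
  /-- Almost surely the equation holds. -/
  solves : ∀ᵐ p ∂(𝕏 : Measure (PathSpace d × PathSpace d)), IsCaratheodorySolution u y p.2 p.1

/-- Any two weak solutions coincide. -/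
def WeakUniqueness {d : ℕ} (u : VelocityField d) (y : Space d)
    (𝕎 : ProbabilityMeasure (PathSpace d)) : Prop :=
  ∀ 𝕏 𝕏' : ProbabilityMeasure (PathSpace d × PathSpace d),
    IsWeakSolution u y 𝕎 𝕏 → IsWeakSolution u y 𝕎 𝕏' → 𝕏 = 𝕏'

/-- `𝕐(dX¹, dX², dW)` is a coupling of two weak solutions with the same noise: both marginals
`𝕐(dX¹, dW)` and `𝕐(dX², dW)` are weak solutions. -/
def IsWeakCoupling {d : ℕ} (u : VelocityField d) (y : Space d)
    (𝕎 : ProbabilityMeasure (PathSpace d))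
    (𝕐 : ProbabilityMeasure (PathSpace d × PathSpace d × PathSpace d)) : Prop :=
  IsWeakSolution u y 𝕎
      (𝕐.map (f := fun p => (p.1, p.2.2)) (by fun_prop)) ∧
    IsWeakSolution u y 𝕎
      (𝕐.map (f := fun p => (p.2.1, p.2.2)) (by fun_prop))

/-- Pathwise uniqueness: in every coupling of two weak solutions, the solutions coincide almost
surely. -/
def PathwiseUniqueness {d : ℕ} (u : VelocityField d) (y : Space d)
    (𝕎 : ProbabilityMeasure (PathSpace d)) : Prop :=
  ∀ 𝕐 : ProbabilityMeasure (PathSpace d × PathSpace d × PathSpace d),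
    IsWeakCoupling u y 𝕎 𝕐 →
      ∀ᵐ p ∂(𝕐 : Measure (PathSpace d × PathSpace d × PathSpace d)), p.1 = p.2.1

/-- The law `π^ε_* 𝕏(dX̃ | W)` of `X|_{[0,ε]}` under the conditional law of `X` given `W`. -/
def condLawUpTo {d : ℕ} (𝕏 : ProbabilityMeasure (PathSpace d × PathSpace d)) (ε : I)
    (W : PathSpace d) : Measure (PathSpaceUpTo d ε) :=
  (condDistrib (fun p : PathSpace d × PathSpace d => p.1) (fun p => p.2)
    (𝕏 : Measure (PathSpace d × PathSpace d)) W).map (restr ε)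

/-- The event `X¹|_{[0,ε]} = X²|_{[0,ε]}` for a triple `(X¹, X², W)`. -/
def coincidence (d : ℕ) (ε : I) : Set (PathSpace d × PathSpace d × PathSpace d) :=
  {p | restr ε p.1 = restr ε p.2.1}

end AdditiveSDE

end

/-! At positive times the equation is classically well posed, so all nonuniqueness is created at
time zero. Two solutions are started at a small time `s`, one from `y` and one from a nearby point
`z`. Then `s → 0` and `z → y`. Explosive separation keeps the two a distance `δ` apart at a fixed
small time with high probability, and the separation survives in the limit.

Limits exist because a solution is its noise path plus a drift part whose modulus of continuity is
controlled by `∫ sup_x |u|`, independently of the start. Arzelà-Ascoli then gives compactness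
(`exists_isCompact_solutions`), and dominated convergence shows that limits solve the equation from
time zero (`isCaratheodorySolution_of_tendsto`). For laws, nonanticipation must also survive. Tested
against continuous functions it is an identity involving the conditional law of the noise, and it
passes to weak limits because regular noise makes that law continuous
(`isNonanticipating_of_tendsto`). A diagonal choice of start points and times, followed by Fatou and
summability, makes separation hold for almost every `u`, or almost every `(u,W)`, along a
subsequence depending on that point. This yields the first conclusion and the statement on
Carathéodory solutions.

For the second conclusion, mix the marginals of countably many such couplings. Where the conditional
law of the mixture is concentrated at one point, every ingredient is the same function of the noise,
so each coupling must coincide there. Arbitrarily small coincidence probability makes that set of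
noise paths null.

For the third, weak uniqueness turns the couplings into self-couplings of one law. A conditional
atom of mass above `1/2` would force coincidence with probability bounded below
(`ae_median_atom_le_half`). Without such atoms, pairing the quantile levels `r` and `r + 1/2` modulo
one gives two copies that almost surely differ (`exists_disjoint_coupling`). -/

noncomputable section

namespace AdditiveSDE

variable {d : ℕ}

/-! ### Velocity fields: sup norms and joint measurability -/

namespace VelocityField

/-- The supremum norm `sup_x |u(t,x)|` of a velocity field at time `t`. -/
def supNorm (u : VelocityField d) (t : ℝ) : ℝ≥0∞ := ⨆ x : Space d, ‖u t x‖ₑ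

theorem continuousOn (u : VelocityField d) :
    ContinuousOn (fun p : ℝ × Space d => u p.1 p.2)
      (Set.Ioc (0 : ℝ) 1 ×ˢ (Set.univ : Set (Space d))) :=
  u.smooth.continuousOn

theorem continuous_apply (u : VelocityField d) (t : ℝ) : Continuous (u t) := by
  by_cases ht : t ∈ Set.Ioc (0 : ℝ) 1
  · have h := u.continuousOn.comp (f := fun x : Space d => (t, x)) (s := Set.univ)
      (by fun_prop) (fun x _ => ⟨ht, trivial⟩)
    exact continuousOn_univ.mp h
  · rw [u.eq_zero t ht]; exact continuous_const

/-- The supremum is uncountable, but its superlevel sets are unions of relatively open subsets of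
`(0,1]`, since each `t ↦ u t x` is continuous there. -/
theorem measurable_supNorm (u : VelocityField d) : Measurable u.supNorm := by
  refine measurable_of_Ioi fun a => ?_
  have : u.supNorm ⁻¹' Set.Ioi a =
      ⋃ x : Space d, (Set.Ioc (0 : ℝ) 1 ∩ (fun t => ‖u t x‖ₑ) ⁻¹' Set.Ioi a) := by
    ext t
    simp only [Set.mem_preimage, Set.mem_Ioi, supNorm, lt_iSup_iff, Set.mem_iUnion, Set.mem_inter_iff]
    refine exists_congr fun x => ⟨fun h => ⟨?_, h⟩, fun h => h.2⟩
    by_contra ht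
    simp [u.eq_zero t ht] at h
  rw [this]
  have hc : ∀ x : Space d, ContinuousOn (fun t => ‖u t x‖ₑ) (Set.Ioc (0 : ℝ) 1) := fun x =>
    (u.continuousOn.comp (f := fun t : ℝ => (t, x)) (s := Set.Ioc (0 : ℝ) 1)
      (by fun_prop) (fun t ht => ⟨ht, trivial⟩)).enorm
  choose U hU hU' using fun x => (continuousOn_iff'.mp (hc x)) _ (isOpen_Ioi (a := a))
  have : (⋃ x : Space d, (Set.Ioc (0 : ℝ) 1 ∩ (fun t => ‖u t x‖ₑ) ⁻¹' Set.Ioi a)) =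
      (⋃ x, U x) ∩ Set.Ioc (0 : ℝ) 1 := by
    rw [Set.iUnion_inter]
    exact Set.iUnion_congr fun x => by rw [← hU' x, Set.inter_comm]
  rw [this]
  exact (isOpen_iUnion hU).measurableSet.inter measurableSet_Ioc

/-- The supremum norm of a velocity field as a real number. -/
def bound (u : VelocityField d) (t : ℝ) : ℝ := (u.supNorm t).toReal

theorem bound_nonneg (u : VelocityField d) (t : ℝ) : 0 ≤ u.bound t := ENNReal.toReal_nonneg

theorem supNorm_eq_zero (u : VelocityField d) {t : ℝ} (ht : t ∉ Set.Ioc (0 : ℝ) 1) :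
    u.supNorm t = 0 := by
  simp [supNorm, u.eq_zero t ht]

theorem lintegral_supNorm (u : VelocityField d) : ∫⁻ t, u.supNorm t < ⊤ := by
  have h : u.supNorm = (Set.Ioc (0 : ℝ) 1).indicator u.supNorm := by
    ext t
    by_cases ht : t ∈ Set.Ioc (0 : ℝ) 1
    · simp [Set.indicator_of_mem ht]
    · rw [Set.indicator_of_notMem ht, u.supNorm_eq_zero ht]
  rw [h, lintegral_indicator measurableSet_Ioc]
  exact u.integrable

theorem integrable_bound (u : VelocityField d) : Integrable u.bound :=
  integrable_toReal_of_lintegral_ne_top u.measurable_supNorm.aemeasurable u.lintegral_supNorm.ne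

theorem ae_norm_le_bound (u : VelocityField d) : ∀ᵐ t : ℝ, ∀ x, ‖u t x‖ ≤ u.bound t := by
  filter_upwards [ae_lt_top u.measurable_supNorm u.lintegral_supNorm.ne] with t ht x
  rw [bound, ← toReal_enorm]
  exact ENNReal.toReal_mono ht.ne (le_iSup (fun x => ‖u t x‖ₑ) x)

end VelocityField

theorem measurable_eval_velocity (t : ℝ) (x : Space d) :
    Measurable (fun u : VelocityField d => u t x) := by
  have h : Measurable (fun u : VelocityField d => u.toFun) := comap_measurable _
  have h1 : Measurable (fun f : ℝ → Space d → Space d => f t) := measurable_pi_apply t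
  have h2 : Measurable (fun f : Space d → Space d => f x) := measurable_pi_apply x
  exact h2.comp (h1.comp h)

/-- A Carathéodory function: continuous in `(t,x)` and measurable in `u`. Continuity holds only over
`(0,1]`; elsewhere the field is zero by normalization. -/
theorem measurable_uncurry_velocity :
    Measurable (fun p : VelocityField d × ℝ × Space d => p.1 p.2.1 p.2.2) := by
  let S : Set (VelocityField d × ℝ × Space d) := {p | p.2.1 ∈ Set.Ioc (0 : ℝ) 1}
  have hS : MeasurableSet S := measurableSet_Ioc.preimage (by fun_prop)
  have h : Measurable (Function.uncurry
      (fun (q : Set.Ioc (0 : ℝ) 1 × Space d) (u : VelocityField d) => u q.1 q.2)) := by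
    refine measurable_uncurry_of_continuous_of_measurable (fun u => ?_)
      (fun q => measurable_eval_velocity _ _)
    have h2 := (continuousOn_iff_continuous_domRestrict.mp u.continuousOn)
    exact h2.comp (f := fun q : Set.Ioc (0 : ℝ) 1 × Space d =>
      (⟨(q.1, q.2), q.1.2, trivial⟩ : ↥(Set.Ioc (0 : ℝ) 1 ×ˢ (Set.univ : Set (Space d)))))
      (by fun_prop)
  refine measurable_of_restrict_of_restrict_compl hS ?_ ?_
  · exact h.comp (g := Function.uncurry
      (fun (q : Set.Ioc (0 : ℝ) 1 × Space d) (u : VelocityField d) => u q.1 q.2))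
      (f := fun p : S => ((⟨p.1.2.1, p.2⟩, p.1.2.2), p.1.1))
      (((((measurable_fst.comp measurable_snd).comp measurable_subtype_coe).subtype_mk).prodMk
        ((measurable_snd.comp measurable_snd).comp measurable_subtype_coe)).prodMk
          (measurable_fst.comp measurable_subtype_coe))
  · have : Sᶜ.domRestrict (fun p : VelocityField d × ℝ × Space d => p.1 p.2.1 p.2.2) = fun _ => 0 := by
      ext1 p
      have := p.1.1.eq_zero p.1.2.1 p.2
      simp only [Set.domRestrict_apply]
      rw [this]; rfl
    rw [this]; exact measurable_const

/-! ### Drift integrals along paths -/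

theorem continuous_at_ (X : PathSpace d) : Continuous (at_ X) :=
  X.continuous.comp continuous_projIcc

theorem at_coe (X : PathSpace d) (t : I) : at_ X t = X t := by
  simp [at_, Set.projIcc_val]

theorem measurable_drift (u : VelocityField d) (X : PathSpace d) :
    Measurable (fun r => u r (at_ X r)) :=
  measurable_uncurry_velocity.comp (f := fun r : ℝ => (u, r, at_ X r))
    (measurable_const.prodMk (measurable_id.prodMk (continuous_at_ X).measurable))

theorem integrable_drift (u : VelocityField d) (X : PathSpace d) :
    Integrable (fun r => u r (at_ X r)) := by
  refine u.integrable_bound.mono' (measurable_drift u X).aestronglyMeasurable ?_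
  filter_upwards [u.ae_norm_le_bound] with t ht using ht _

/-- The integrated bound `∫₀¹ sup_x |u(t,x)| dt`. -/
def VelocityField.mass (u : VelocityField d) : ℝ := ∫ t, u.bound t

theorem norm_integral_drift_le (u : VelocityField d) (X : PathSpace d) {a b : ℝ} (hab : a ≤ b) :
    ‖∫ r in a..b, u r (at_ X r)‖ ≤ ∫ r in a..b, u.bound r := by
  refine intervalIntegral.norm_integral_le_of_norm_le hab ?_ u.integrable_bound.intervalIntegrable
  filter_upwards [u.ae_norm_le_bound] with t ht _ using ht _

theorem integral_bound_le_mass (u : VelocityField d) {a b : ℝ} (hab : a ≤ b) :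
    ∫ r in a..b, u.bound r ≤ u.mass := by
  rw [intervalIntegral.integral_of_le hab]
  exact setIntegral_le_integral u.integrable_bound (ae_of_all _ u.bound_nonneg)

/-! ### Picard iteration from a positive time -/

/-- The Picard map for the equation started from `x` at time `s`. -/
def picardMap (s : I) (x : Space d) (u : VelocityField d) (W X : PathSpace d) : PathSpace d where
  toFun t := x + (∫ r in (s : ℝ)..max s t, u r (at_ X r)) + W (max s t) - W s
  continuous_toFun := by
    have h : Continuous fun b : ℝ => ∫ r in (s : ℝ)..b, u r (at_ X r) :=
      intervalIntegral.continuous_primitive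
        (fun a b => (integrable_drift u X).intervalIntegrable) _
    have h2 : Continuous fun t : I => ∫ r in (s : ℝ)..max s t, u r (at_ X r) :=
      h.comp (f := fun t : I => (max (s : ℝ) t)) (by fun_prop)
    fun_prop

theorem picardMap_apply (s : I) (x : Space d) (u : VelocityField d) (W X : PathSpace d) (t : I) :
    picardMap s x u W X t =
      x + (∫ r in (s : ℝ)..max s t, u r (at_ X r)) + W (max s t) - W s := rfl

/-- The `max s t` in the Picard map freezes the path at `x` before time `s`, which is the convention
in `IsSolutionFrom`; fixed points therefore match on all of `[0,1]`. -/
theorem isSolutionFrom_iff (s : I) (x : Space d) (u : VelocityField d) (W X : PathSpace d) :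
    IsSolutionFrom u s x W X ↔ picardMap s x u W X = X := by
  constructor
  · rintro ⟨h1, h2⟩
    ext1 t
    rw [picardMap_apply]
    rcases le_total t s with h | h
    · rw [h1 t h, max_eq_left h, max_eq_left (by exact_mod_cast h)]; simp
    · rw [h2 t h, max_eq_right h, max_eq_right (by exact_mod_cast h)]
  · intro h
    refine ⟨fun t ht => ?_, fun t ht => ?_⟩ <;> rw [← h, picardMap_apply]
    · rw [max_eq_left ht, max_eq_left (by exact_mod_cast ht)]; simp
    · rw [max_eq_right ht, max_eq_right (by exact_mod_cast ht), h]

/-- The bound does not involve `X`, so iterates and solutions all stay in one ball, and a local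
Lipschitz constant suffices. -/
theorem norm_picardMap_le (s : I) (x : Space d) (u : VelocityField d) (W X : PathSpace d) (t : I) :
    ‖picardMap s x u W X t‖ ≤ ‖x‖ + u.mass + 2 * ‖W‖ := by
  rw [picardMap_apply]
  have h1 : ‖∫ r in (s : ℝ)..max s t, u r (at_ X r)‖ ≤ u.mass :=
    (norm_integral_drift_le u X (le_max_left _ _)).trans (integral_bound_le_mass u (le_max_left _ _))
  have h2 := W.norm_coe_le_norm (max s t)
  have h3 := W.norm_coe_le_norm s
  calc _ ≤ ‖x + (∫ r in (s : ℝ)..max s t, u r (at_ X r)) + W (max s t)‖ + ‖W s‖ := norm_sub_le _ _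
    _ ≤ ‖x + (∫ r in (s : ℝ)..max s t, u r (at_ X r))‖ + ‖W (max s t)‖ + ‖W s‖ := by
      gcongr; exact norm_add_le _ _
    _ ≤ ‖x‖ + ‖∫ r in (s : ℝ)..max s t, u r (at_ X r)‖ + ‖W (max s t)‖ + ‖W s‖ := by
      gcongr; exact norm_add_le _ _
    _ ≤ _ := by linarith

/-- Smoothness on the convex set `(0,1] × ℝᵈ` gives local Lipschitz bounds, made uniform on a
compact cylinder. The constant may blow up as `s → 0`, which is where uniqueness is lost. -/
theorem VelocityField.exists_lipschitz (u : VelocityField d) {s : ℝ} (hs : 0 < s) (R : ℝ) :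
    ∃ L : ℝ, 0 ≤ L ∧ ∀ r ∈ Set.Icc s 1, ∀ z ∈ Metric.closedBall (0 : Space d) R,
      ∀ z' ∈ Metric.closedBall (0 : Space d) R, ‖u r z - u r z'‖ ≤ L * ‖z - z'‖ := by
  let D : Set (ℝ × Space d) := Set.Ioc (0 : ℝ) 1 ×ˢ Set.univ
  have hD : Convex ℝ D := (convex_Ioc 0 1).prod convex_univ
  have hl : LocallyLipschitzOn D (fun p : ℝ × Space d => u p.1 p.2) := fun p hp =>
    ((u.smooth p hp).of_le (by exact_mod_cast le_top)).exists_lipschitzOnWith hD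
  let K : Set (ℝ × Space d) := Set.Icc s 1 ×ˢ Metric.closedBall 0 R
  have hKD : K ⊆ D := Set.prod_mono (fun r hr => ⟨hs.trans_le hr.1, hr.2⟩) (Set.subset_univ _)
  have hK : IsCompact K := isCompact_Icc.prod (isCompact_closedBall 0 R)
  obtain ⟨L, hL⟩ := (hl.mono hKD).exists_lipschitzOnWith_of_compact hK
  refine ⟨L, L.2, fun r hr z hz z' hz' => ?_⟩
  have := hL.dist_le_mul (r, z) ⟨hr, hz⟩ (r, z') ⟨hr, hz'⟩
  simpa [dist_eq_norm, Prod.dist_eq] using this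

theorem integral_pow_div_factorial (C L s t : ℝ) (n : ℕ) :
    ∫ r in s..t, L * (C * (L * (r - s)) ^ n / n.factorial) =
      C * (L * (t - s)) ^ (n + 1) / (n + 1).factorial := by
  have h1 : ∀ r, L * (C * (L * (r - s)) ^ n / n.factorial) =
      (L * C * L ^ n / n.factorial) * (r - s) ^ n := fun r => by rw [mul_pow]; ring
  simp_rw [h1]
  rw [intervalIntegral.integral_const_mul,
    intervalIntegral.integral_comp_sub_right (fun r => r ^ n) s, integral_pow, Nat.factorial_succ]
  push_cast
  have : (n : ℝ) + 1 ≠ 0 := by positivity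
  have : (n.factorial : ℝ) ≠ 0 := by positivity
  rw [mul_pow, pow_succ L]
  field_simp
  simp

/-- Each application integrates the previous error once more. The resulting factorial gain gives
convergence on the whole interval whatever the size of `L`. -/
theorem picardMap_step {s : I} (x : Space d) (u : VelocityField d) (W : PathSpace d)
    {X Y : PathSpace d} {L R C : ℝ} {n : ℕ} 
    (hL : 0 ≤ L ∧ ∀ r ∈ Set.Icc (s : ℝ) 1, ∀ z ∈ Metric.closedBall (0 : Space d) R,
      ∀ z' ∈ Metric.closedBall (0 : Space d) R, ‖u r z - u r z'‖ ≤ L * ‖z - z'‖)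
    (hX : ∀ t, ‖X t‖ ≤ R) (hY : ∀ t, ‖Y t‖ ≤ R)
    (h : ∀ t, s ≤ t → ‖X t - Y t‖ ≤ C * (L * (t - s)) ^ n / n.factorial) (t : I) (ht : s ≤ t) :
    ‖picardMap s x u W X t - picardMap s x u W Y t‖ ≤
      C * (L * (t - s)) ^ (n + 1) / (n + 1).factorial := by
  have ht' : (s : ℝ) ≤ t := by exact_mod_cast ht
  rw [picardMap_apply, picardMap_apply, max_eq_right ht', max_eq_right ht]
  have h1 : x + (∫ r in (s : ℝ)..t, u r (at_ X r)) + W t - W s -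
      (x + (∫ r in (s : ℝ)..t, u r (at_ Y r)) + W t - W s) =
      ∫ r in (s : ℝ)..t, (u r (at_ X r) - u r (at_ Y r)) := by
    rw [intervalIntegral.integral_sub (integrable_drift u X).intervalIntegrable
      (integrable_drift u Y).intervalIntegrable]
    abel
  rw [h1, ← integral_pow_div_factorial C L s t n]
  refine intervalIntegral.norm_integral_le_of_norm_le ht' (ae_of_all _ fun r hr => ?_)
    (Continuous.intervalIntegrable (by fun_prop) _ _)
  have hr1 : r ∈ Set.Icc (s : ℝ) 1 := ⟨hr.1.le, hr.2.trans t.2.2⟩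
  have hrI : r ∈ Set.Icc (0 : ℝ) 1 := ⟨s.2.1.trans hr.1.le, hr1.2⟩
  have hXr : at_ X r = X ⟨r, hrI⟩ := at_coe X ⟨r, hrI⟩
  have hYr : at_ Y r = Y ⟨r, hrI⟩ := at_coe Y ⟨r, hrI⟩
  refine (hL.2 r hr1 _ ?_ _ ?_).trans ?_
  · rw [hXr]; simpa using hX _
  · rw [hYr]; simpa using hY _
  · rw [hXr, hYr]
    exact mul_le_mul_of_nonneg_left (h ⟨r, hrI⟩ hr.1.le) hL.1

/-- The Picard iterates for the equation started from `x` at time `s`. -/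
def picard (s : I) (x : Space d) (u : VelocityField d) (W : PathSpace d) : ℕ → PathSpace d
  | 0 => ContinuousMap.const I x
  | n + 1 => picardMap s x u W (picard s x u W n)

theorem norm_picard_le (s : I) (x : Space d) (u : VelocityField d) (W : PathSpace d) (n : ℕ)
    (t : I) : ‖picard s x u W n t‖ ≤ ‖x‖ + u.mass + 2 * ‖W‖ := by
  cases n with
  | zero =>
    have : 0 ≤ u.mass := integral_nonneg u.bound_nonneg
    simp only [picard, ContinuousMap.const_apply]
    linarith [norm_nonneg W]
  | succ n => exact norm_picardMap_le s x u W _ t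

theorem norm_sub_le_factorial_bound {L C : ℝ} (hL : 0 ≤ L) (hC : 0 ≤ C) {s t : I} (n : ℕ)
    (hst : s ≤ t) :
    C * (L * (t - s)) ^ n / n.factorial ≤ C * (L ^ n / n.factorial) := by
  rw [mul_div_assoc]
  have h0 : (0 : ℝ) ≤ t - s := sub_nonneg.mpr (by exact_mod_cast hst)
  have h1 : (t - s : ℝ) ≤ 1 := by linarith [t.2.2, s.2.1]
  gcongr
  nlinarith

theorem picard_apply_of_le {s : I} (x : Space d) (u : VelocityField d) (W : PathSpace d) (n : ℕ)
    {t : I} (ht : t ≤ s) : picard s x u W n t = x := by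
  cases n with
  | zero => rfl
  | succ n =>
    rw [picard, picardMap_apply, max_eq_left ht, max_eq_left (by exact_mod_cast ht)]; simp

theorem exists_tendsto_picard {s : I} (hs : 0 < s) (x : Space d) (u : VelocityField d)
    (W : PathSpace d) :
    ∃ X, Tendsto (picard s x u W) atTop (𝓝 X) ∧ IsSolutionFrom u s x W X := by
  set R := ‖x‖ + u.mass + 2 * ‖W‖
  have hR : 0 ≤ R := (norm_nonneg _).trans (norm_picard_le s x u W 0 s)
  obtain ⟨L, hL⟩ := u.exists_lipschitz (s := s) (by exact_mod_cast hs) R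
  have key : ∀ n t, s ≤ t → ‖picard s x u W n t - picard s x u W (n + 1) t‖ ≤
      2 * R * (L * (t - s)) ^ n / n.factorial := by
    intro n
    induction n with
    | zero =>
      intro t _
      have := norm_sub_le (picard s x u W 0 t) (picard s x u W 1 t)
      have h0 := norm_picard_le s x u W 0 t
      have h1 := norm_picard_le s x u W 1 t
      simp only [pow_zero, mul_one, Nat.factorial_zero, Nat.cast_one, div_one, zero_add]
      linarith
    | succ n ih =>
      intro t ht
      exact picardMap_step x u W hL (norm_picard_le s x u W n) (norm_picard_le s x u W (n + 1))
        ih t ht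
  have hdist : ∀ n, dist (picard s x u W n) (picard s x u W (n + 1)) ≤
      2 * R * (L ^ n / n.factorial) := fun n => by
    refine (ContinuousMap.dist_le (by have := hL.1; positivity)).mpr fun t => ?_
    rw [dist_eq_norm]
    rcases le_total s t with h | h
    · exact (key n t h).trans (norm_sub_le_factorial_bound hL.1 (by positivity) n h)
    · rw [picard_apply_of_le x u W n h, picard_apply_of_le x u W (n + 1) h, sub_self, norm_zero]
      have := hL.1; positivity
  obtain ⟨X, hX⟩ := cauchySeq_tendsto_of_complete (cauchySeq_of_dist_le_of_summable _ hdist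
    ((Real.summable_pow_div_factorial L).mul_left _))
  refine ⟨X, hX, (isSolutionFrom_iff s x u W X).mpr ?_⟩
  have hXt : ∀ t, Tendsto (fun n => picard s x u W n t) atTop (𝓝 (X t)) := fun t =>
    ((continuous_eval_const t).tendsto X).comp hX
  have hXR : ∀ t, ‖X t‖ ≤ R := fun t =>
    le_of_tendsto (hXt t).norm (Eventually.of_forall fun n => norm_picard_le s x u W n t)
  ext1 t
  have h2 : Tendsto (fun n => picard s x u W (n + 1) t) atTop (𝓝 (picardMap s x u W X t)) := by
    rcases le_total s t with h | h
    · rw [tendsto_iff_dist_tendsto_zero]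
      refine squeeze_zero (fun _ => dist_nonneg) (g := fun n => L * dist (picard s x u W n) X)
        (fun n => ?_) ?_
      · rw [dist_eq_norm]
        have := picardMap_step x u W (n := 0) (C := dist (picard s x u W n) X) hL
          (norm_picard_le s x u W n) hXR (fun t _ => by
            simp only [pow_zero, mul_one, Nat.factorial_zero, Nat.cast_one, div_one]
            rw [← dist_eq_norm]; exact ContinuousMap.dist_apply_le_dist t) t h
        refine this.trans ((norm_sub_le_factorial_bound hL.1 dist_nonneg _ h).trans ?_)
        simp [mul_comm]
      · simpa using (tendsto_iff_dist_tendsto_zero.mp hX).const_mul L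
    · rw [picardMap_apply, max_eq_left h, max_eq_left (by exact_mod_cast h)]
      simp_rw [picard_apply_of_le x u W _ h]; simp
  exact tendsto_nhds_unique h2 ((hXt t).comp (tendsto_add_atTop_nat 1))

theorem IsSolutionFrom.unique {s : I} (hs : 0 < s) {x : Space d} {u : VelocityField d}
    {W X Y : PathSpace d} (hX : IsSolutionFrom u s x W X) (hY : IsSolutionFrom u s x W Y) :
    X = Y := by
  set R := ‖x‖ + u.mass + 2 * ‖W‖
  obtain ⟨L, hL⟩ := u.exists_lipschitz (s := s) (by exact_mod_cast hs) R
  have hX' := (isSolutionFrom_iff s x u W X).mp hX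
  have hY' := (isSolutionFrom_iff s x u W Y).mp hY
  have hXR : ∀ t, ‖X t‖ ≤ R := fun t => by rw [← hX']; exact norm_picardMap_le s x u W X t
  have hYR : ∀ t, ‖Y t‖ ≤ R := fun t => by rw [← hY']; exact norm_picardMap_le s x u W Y t
  ext1 t
  rcases le_total s t with h | h
  · have key : ∀ n t, s ≤ t → ‖X t - Y t‖ ≤ dist X Y * (L * (t - s)) ^ n / n.factorial := by
      intro n
      induction n with
      | zero =>
        intro t _
        simp only [pow_zero, mul_one, Nat.factorial_zero, Nat.cast_one, div_one]
        rw [← dist_eq_norm]; exact ContinuousMap.dist_apply_le_dist t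
      | succ n ih =>
        intro t ht
        have := picardMap_step x u W hL hXR hYR ih t ht
        rwa [hX', hY'] at this
    have hlim : Tendsto (fun n : ℕ => dist X Y * (L ^ n / n.factorial)) atTop (𝓝 0) := by
      simpa using (FloorSemiring.tendsto_pow_div_factorial_atTop L).const_mul (dist X Y)
    have := ge_of_tendsto hlim (Eventually.of_forall fun n =>
      (key n t h).trans (norm_sub_le_factorial_bound hL.1 dist_nonneg n h))
    exact sub_eq_zero.mp (norm_le_zero_iff.mp this)
  · rw [hX.1 t h, hY.1 t h]

theorem isSolutionFrom_flow {s : I} (hs : 0 < s) (x : Space d) (u : VelocityField d)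
    (W : PathSpace d) : IsSolutionFrom u s x W (flow s x u W) := by
  have h : ∃ X : PathSpace d, IsSolutionFrom u s x W X :=
    (exists_tendsto_picard hs x u W).imp fun _ h => h.2
  rw [flow, dif_pos h]
  exact h.choose_spec

/-- The flow, defined by choice, is a limit of explicit iterates; measurability and adaptedness are
inherited from them. -/
theorem tendsto_picard {s : I} (hs : 0 < s) (x : Space d) (u : VelocityField d)
    (W : PathSpace d) : Tendsto (picard s x u W) atTop (𝓝 (flow s x u W)) := by
  obtain ⟨X, hX, hsol⟩ := exists_tendsto_picard hs x u W
  rwa [← hsol.unique hs (isSolutionFrom_flow hs x u W)]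

/-! ### Measurability of the flow in the field and the noise -/

/-- Membership in a closed ball is a condition at countably many dense times, and separability
writes every open set as a countable union of closed balls. -/
theorem measurable_paths_of_eval {X Ω : Type*} [TopologicalSpace X] [CompactSpace X]
    [SecondCountableTopology X] [LocallyCompactSpace X] [MeasurableSpace Ω]
    {f : Ω → C(X, Space d)} (h : ∀ t, Measurable fun o => f o t) : Measurable f := by
  rcases isEmpty_or_nonempty X with hX | hX
  · have : f = fun _ => 0 := by ext1 o; ext1 x; exact hX.elim x
    rw [this]; exact measurable_const
  have hball : ∀ (g : C(X, Space d)) (r : ℝ), MeasurableSet (f ⁻¹' Metric.closedBall g r) := by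
    intro g r
    have : f ⁻¹' Metric.closedBall g r =
        ⋂ n, {o | dist (f o (TopologicalSpace.denseSeq X n))
          (g (TopologicalSpace.denseSeq X n)) ≤ r} := by
      ext o
      simp only [Set.mem_preimage, Metric.mem_closedBall, Set.mem_iInter, Set.mem_ofPred_eq]
      refine ⟨fun h n => (ContinuousMap.dist_apply_le_dist _).trans h, fun h => ?_⟩
      have hr : 0 ≤ r := dist_nonneg.trans (h 0)
      refine (ContinuousMap.dist_le hr).mpr fun x => ?_
      have hc : IsClosed {x | dist (f o x) (g x) ≤ r} :=
        isClosed_le (by fun_prop) continuous_const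
      exact (TopologicalSpace.denseRange_denseSeq X).induction_on (p := fun x =>
        dist (f o x) (g x) ≤ r) x hc h
    rw [this]
    exact MeasurableSet.iInter fun n => measurableSet_le ((h _).dist measurable_const)
      measurable_const
  refine measurable_of_isOpen fun U hU => ?_
  have hU' : U = ⋃ (n : ℕ) (m : ℕ) (_ : Metric.closedBall
      (TopologicalSpace.denseSeq C(X, Space d) n) (1 / (m + 1 : ℝ)) ⊆ U),
      Metric.closedBall (TopologicalSpace.denseSeq C(X, Space d) n) (1 / (m + 1 : ℝ)) := by
    refine subset_antisymm (fun x hx => ?_) (by simp)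
    obtain ⟨ε, hε, hεU⟩ := Metric.isOpen_iff.mp hU x hx
    obtain ⟨m, hm⟩ := exists_nat_one_div_lt (half_pos hε)
    obtain ⟨n, hn⟩ := (TopologicalSpace.denseRange_denseSeq C(X, Space d)).exists_dist_lt x
      (Nat.one_div_pos_of_nat (α := ℝ) (n := m))
    refine Set.mem_iUnion.mpr ⟨n, Set.mem_iUnion.mpr ⟨m, Set.mem_iUnion.mpr ⟨?_, hn.le⟩⟩⟩
    refine fun z hz => hεU ?_
    have hz' : dist z _ ≤ _ := hz
    have := dist_triangle_right z x (TopologicalSpace.denseSeq C(X, Space d) n)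
    rw [Metric.mem_ball]
    linarith
  rw [hU']
  simp only [Set.preimage_iUnion]
  exact .iUnion fun n => .iUnion fun m => .iUnion fun _ => hball _ _

theorem measurable_integral_drift {Ω : Type*} [MeasurableSpace Ω] {u : Ω → VelocityField d}
    {X : Ω → PathSpace d} (hu : Measurable u) (hX : Measurable X) {a b : ℝ} (hab : a ≤ b) :
    Measurable fun o => ∫ r in a..b, u o r (at_ (X o) r) := by
  simp_rw [intervalIntegral.integral_of_le hab]
  have hat : Measurable (fun p : Ω × ℝ => at_ (X p.1) p.2) := by
    have hc : Continuous fun q : PathSpace d × ℝ => q.1 (Set.projIcc 0 1 zero_le_one q.2) := by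
      fun_prop
    exact hc.measurable.comp ((hX.comp measurable_fst).prodMk measurable_snd)
  have hm : Measurable (fun p : Ω × ℝ => u p.1 p.2 (at_ (X p.1) p.2)) :=
    measurable_uncurry_velocity.comp (f := fun p : Ω × ℝ => (u p.1, p.2, at_ (X p.1) p.2))
      ((hu.comp measurable_fst).prodMk (measurable_snd.prodMk hat))
  exact (hm.stronglyMeasurable.integral_prod_right' (ν := volume.restrict (Set.Ioc a b))).measurable

theorem measurable_eval_path (t : I) : Measurable fun X : PathSpace d => X t :=
  (continuous_eval_const t).measurable

theorem measurable_picard (s : I) (x : Space d) (n : ℕ) :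
    Measurable fun p : VelocityField d × PathSpace d => picard s x p.1 p.2 n := by
  induction n with
  | zero => exact measurable_const
  | succ n ih =>
    refine measurable_paths_of_eval fun t => ?_
    simp only [picard, picardMap_apply]
    have h1 := measurable_integral_drift (measurable_fst (β := PathSpace d)) ih
      (le_max_left (s : ℝ) t)
    have h2 : ∀ r : I, Measurable fun p : VelocityField d × PathSpace d => p.2 r := fun r =>
      (measurable_eval_path r).comp measurable_snd
    exact ((h1.const_add x).add (h2 _)).sub (h2 _)

theorem measurable_flow {s : I} (hs : 0 < s) (x : Space d) :
    Measurable fun p : VelocityField d × PathSpace d => flow s x p.1 p.2 :=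
  measurable_of_tendsto_metrizable (measurable_picard s x)
    (tendsto_pi_nhds.mpr fun p => tendsto_picard hs x p.1 p.2)

theorem measurable_flow_noise {s : I} (hs : 0 < s) (x : Space d) (u : VelocityField d) :
    Measurable (flow s x u) :=
  (measurable_flow hs x).comp (f := fun W => (u, W)) measurable_prodMk_left

/-! ### Adaptedness of the flow -/

/-- The extension of a path on `[0,t]` to `[0,1]` by its value at time `t`. -/
def extend (t : I) (w : PathSpaceUpTo d t) : PathSpace d :=
  w.comp ⟨fun r => ⟨min r t, min_le_right r t⟩, by fun_prop⟩

theorem continuous_extend (t : I) : Continuous (extend (d := d) t) :=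
  ContinuousMap.continuous_precomp _

theorem extend_restr_apply {r t : I} (W : PathSpace d) :
    extend t (restr t W) r = W (min r t) := rfl

theorem picard_extend (s : I) (x : Space d) (u : VelocityField d) (W : PathSpace d) (t : I)
    (hst : s ≤ t) (n : ℕ) (r : I) (hr : r ≤ t) :
    picard s x u (extend t (restr t W)) n r = picard s x u W n r := by
  induction n generalizing r with
  | zero => rfl
  | succ n ih =>
    simp only [picard, picardMap_apply]
    rw [extend_restr_apply, extend_restr_apply, min_eq_left hst, min_eq_left (max_le hst hr)]
    have : ∫ r in (s : ℝ)..max s r, u r (at_ (picard s x u (extend t (restr t W)) n) r) =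
        ∫ r in (s : ℝ)..max s r, u r (at_ (picard s x u W n) r) := by
      refine intervalIntegral.integral_congr fun q hq => ?_
      rw [Set.uIcc_of_le (le_max_left _ _)] at hq
      have hqt : q ≤ t := hq.2.trans (max_le hst hr)
      have hqI : q ∈ Set.Icc (0 : ℝ) 1 := ⟨s.2.1.trans hq.1, hqt.trans t.2.2⟩
      have := ih ⟨q, hqI⟩ hqt
      simp only [at_, Set.projIcc_of_mem _ hqI, this]
    rw [this]

/-- Adaptedness: the Picard iterates up to time `t` only see the noise up to `t`, and this passes to
their limit. For `t ≤ s` both paths are still constant. -/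
theorem restr_flow {s : I} (hs : 0 < s) (x : Space d) (u : VelocityField d) (W : PathSpace d)
    (t : I) : restr t (flow s x u W) = restr t (flow s x u (extend t (restr t W))) := by
  ext1 r
  have hrt : (r : I) ≤ t := r.2
  change flow s x u W r = flow s x u (extend t (restr t W)) r
  rcases le_total s t with hst | hst
  · refine tendsto_nhds_unique (((continuous_eval_const (r : I)).tendsto _).comp
      (tendsto_picard hs x u W)) ?_
    refine (((continuous_eval_const (r : I)).tendsto _).comp
      (tendsto_picard hs x u (extend t (restr t W)))).congr fun n => ?_
    exact picard_extend s x u W t hst n r hrt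
  · rw [(isSolutionFrom_flow hs x u W).1 r (hrt.trans hst),
      (isSolutionFrom_flow hs x u _).1 r (hrt.trans hst)]

/-! ### Limits of solutions as the starting time tends to zero -/

theorem tendsto_at {X : PathSpace d} {Xs : ℕ → PathSpace d} (h : Tendsto Xs atTop (𝓝 X)) (r : ℝ) :
    Tendsto (fun k => at_ (Xs k) r) atTop (𝓝 (at_ X r)) :=
  ((continuous_eval_const _).tendsto X).comp h

/-- No regularity of `u` at time zero is needed: at each fixed positive time `u` is continuous in
space, and `sup_x |u|` dominates. -/
theorem isCaratheodorySolution_of_tendsto {u : VelocityField d} {y : Space d} {W X : PathSpace d}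
    {s : ℕ → I} {x : ℕ → Space d} {Ws Xs : ℕ → PathSpace d} (hs : Tendsto s atTop (𝓝 0))
    (hx : Tendsto x atTop (𝓝 y)) (hW : Tendsto Ws atTop (𝓝 W)) (hX : Tendsto Xs atTop (𝓝 X))
    (hsol : ∀ k, IsSolutionFrom u (s k) (x k) (Ws k) (Xs k)) : IsCaratheodorySolution u y W X := by
  intro t
  have hW2 : ∀ τ : ℕ → I, ∀ τ₀, Tendsto τ atTop (𝓝 τ₀) →
      Tendsto (fun k => Ws k (τ k)) atTop (𝓝 (W τ₀)) := fun τ τ₀ h =>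
    ((continuous_eval (F := PathSpace d)).tendsto (W, τ₀)).comp (hW.prodMk_nhds h)
  have hmax : Tendsto (fun k => max (s k) t) atTop (𝓝 t) := by
    have := hs.max (tendsto_const_nhds (x := t))
    rwa [max_eq_right unitInterval.nonneg'] at this
  have hsR : Tendsto (fun k => (s k : ℝ)) atTop (𝓝 0) :=
    (continuous_subtype_val.tendsto (0 : I)).comp hs
  have hint : Tendsto (fun k => ∫ r in (s k : ℝ)..max (s k) t, u r (at_ (Xs k) r)) atTop
      (𝓝 (∫ r in (0 : ℝ)..t, u r (at_ X r))) := by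
    -- An indicator absorbs the moving lower limit, so that all integrals run over `(0,t]`. If `t <
    -- s k`, both sides vanish.
    have e1 : ∀ k, ∫ r in (s k : ℝ)..max (s k) t, u r (at_ (Xs k) r) =
        ∫ r in Set.Ioc (0 : ℝ) t, (Set.Ioi (s k : ℝ)).indicator
          (fun r => u r (at_ (Xs k) r)) r := by
      intro k
      rw [intervalIntegral.integral_of_le (le_max_left _ _),
        setIntegral_indicator measurableSet_Ioi]
      congr 2
      ext r
      have := (s k).2.1
      simp only [Set.mem_Ioc, Set.mem_inter_iff, Set.mem_Ioi, le_max_iff]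
      constructor
      · rintro ⟨h1, h2⟩
        exact ⟨⟨by linarith, h2.resolve_left (not_le.mpr h1)⟩, h1⟩
      · rintro ⟨h1, h2⟩
        exact ⟨h2, Or.inr h1.2⟩
    simp_rw [e1]
    rw [intervalIntegral.integral_of_le t.2.1]
    refine tendsto_integral_of_dominated_convergence u.bound
      (fun k => ((measurable_drift u (Xs k)).indicator measurableSet_Ioi).aestronglyMeasurable)
      u.integrable_bound.integrableOn (fun k => ?_) ?_
    · filter_upwards [ae_restrict_of_ae u.ae_norm_le_bound] with r hr
      exact (norm_indicator_le_norm_self _ _).trans (hr _)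
    · filter_upwards [ae_restrict_mem measurableSet_Ioc] with r hr
      have h1 : Tendsto (fun k => u r (at_ (Xs k) r)) atTop (𝓝 (u r (at_ X r))) :=
        ((u.continuous_apply r).tendsto _).comp (tendsto_at hX r)
      refine h1.congr' ?_
      filter_upwards [hsR.eventually_lt_const hr.1] with k hk
      rw [Set.indicator_of_mem (Set.mem_Ioi.mpr hk)]
  have hlim := ((hx.add hint).add (hW2 _ _ hmax)).sub (hW2 _ _ hs)
  refine tendsto_nhds_unique (((continuous_eval_const t).tendsto X).comp hX) (hlim.congr fun k => ?_)
  have := (isSolutionFrom_iff _ _ _ _ _).mp (hsol k)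
  change _ = Xs k t
  conv_rhs => rw [← this, picardMap_apply]

/-- The path `x + A + W(· ∨ s) - W(s)`. -/
def shiftPath (p : Space d × I × PathSpace d × PathSpace d) : PathSpace d where
  toFun t := p.1 + p.2.2.1 t + p.2.2.2 (max p.2.1 t) - p.2.2.2 p.2.1
  continuous_toFun := by fun_prop

theorem continuous_shiftPath : Continuous (shiftPath (d := d)) := by
  refine ContinuousMap.continuous_of_continuous_uncurry _ ?_
  simp only [shiftPath, Function.uncurry_def, ContinuousMap.coe_mk]
  fun_prop

/-- The possible drift parts of solutions with velocity field `u`. -/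
def driftPaths (u : VelocityField d) : Set (PathSpace d) :=
  {A | A 0 = 0 ∧ ∀ t t' : I, ‖A t - A t'‖ ≤ |∫ r in (t : ℝ)..t', u.bound r|}

theorem continuous_integral_bound (u : VelocityField d) (a : ℝ) :
    Continuous fun b : ℝ => ∫ r in a..b, u.bound r :=
  intervalIntegral.continuous_primitive (fun _ _ => u.integrable_bound.intervalIntegrable) _

/-- Arzelà-Ascoli with the common modulus `∫ u.bound`. The conditions are pointwise closed and
already force continuity, so the set stays closed in the product topology, inside a product of
balls. -/
theorem isCompact_driftPaths (u : VelocityField d) : IsCompact (driftPaths u) := by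
  have heq : Equicontinuous ((↑) : driftPaths u → I → Space d) := by
    intro t
    rw [Metric.equicontinuousAt_iff_right]
    intro ε hε
    have h := ((continuous_integral_bound u t).abs.comp continuous_subtype_val).tendsto t
    simp only [Function.comp_apply, intervalIntegral.integral_same, abs_zero] at h
    filter_upwards [h.eventually_lt_const hε] with t' ht' A
    rw [dist_eq_norm]
    exact (A.2.2 t t').trans_lt ht'
  refine ArzelaAscoli.isCompact_of_equicontinuous _ ?_ heq
  have himg : ContinuousMap.toFun '' driftPaths u =
      {f : I → Space d | f 0 = 0 ∧ ∀ t t' : I, ‖f t - f t'‖ ≤ |∫ r in (t : ℝ)..t', u.bound r|} := by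
    ext f
    constructor
    · rintro ⟨A, hA, rfl⟩; exact hA
    · intro hf
      have hfc : Continuous f := by
        rw [continuous_iff_continuousAt]
        intro t
        rw [ContinuousAt, tendsto_iff_norm_sub_tendsto_zero]
        have h := ((continuous_integral_bound u t).abs.comp continuous_subtype_val).tendsto t
        simp only [Function.comp_apply, intervalIntegral.integral_same, abs_zero] at h
        exact squeeze_zero (fun _ => norm_nonneg _)
          (fun t' => by rw [norm_sub_rev]; exact hf.2 t t') h
      exact ⟨⟨f, hfc⟩, hf, rfl⟩
  rw [himg]
  refine (isCompact_univ_pi fun _ : I => isCompact_closedBall (0 : Space d) u.mass).of_isClosed_subset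
    ?_ ?_
  · have : {f : I → Space d | f 0 = 0 ∧
        ∀ t t' : I, ‖f t - f t'‖ ≤ |∫ r in (t : ℝ)..t', u.bound r|} = {f | f 0 = 0} ∩
        ⋂ (t : I) (t' : I), {f | ‖f t - f t'‖ ≤ |∫ r in (t : ℝ)..t', u.bound r|} := by
      ext f; simp only [Set.mem_inter_iff, Set.mem_iInter, Set.mem_ofPred_eq]
    rw [this]
    exact (isClosed_eq (by fun_prop) continuous_const).inter (isClosed_iInter fun t =>
      isClosed_iInter fun t' => isClosed_le (by fun_prop) continuous_const)
  · rintro f ⟨h0, hf⟩ t -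
    have := hf t 0
    rw [h0, sub_zero] at this
    rw [mem_closedBall_zero_iff]
    refine this.trans ?_
    have h2 := integral_bound_le_mass u t.2.1
    rw [intervalIntegral.integral_symm, abs_neg, abs_of_nonneg]
    · exact h2
    · exact intervalIntegral.integral_nonneg t.2.1 fun r _ => u.bound_nonneg r

theorem IsSolutionFrom.exists_shiftPath {u : VelocityField d} {s : I} {x : Space d}
    {W X : PathSpace d} (h : IsSolutionFrom u s x W X) :
    ∃ A ∈ driftPaths u, X = shiftPath (x, s, A, W) := by
  have hc : Continuous fun t : I => ∫ r in (s : ℝ)..max s t, u r (at_ X r) :=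
    (intervalIntegral.continuous_primitive
      (fun a b => (integrable_drift u X).intervalIntegrable) _).comp
      (f := fun t : I => (max (s : ℝ) t)) (by fun_prop)
  refine ⟨⟨_, hc⟩, ⟨?_, ?_⟩, ?_⟩
  · simp [max_eq_left s.2.1]
  · have key : ∀ t t' : I, t ≤ t' → ‖(∫ r in (s : ℝ)..max s t', u r (at_ X r)) -
        ∫ r in (s : ℝ)..max s t, u r (at_ X r)‖ ≤ |∫ r in (t : ℝ)..t', u.bound r| := by
      intro t t' h
      have h' : (t : ℝ) ≤ t' := h
      rw [intervalIntegral.integral_interval_sub_left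
        (integrable_drift u X).intervalIntegrable (integrable_drift u X).intervalIntegrable]
      refine (norm_integral_drift_le u X (max_le_max_left _ h')).trans (le_trans ?_ (le_abs_self _))
      rcases le_total (s : ℝ) t with hs | hs
      · rw [max_eq_right hs, max_eq_right (hs.trans h')]
      · rw [max_eq_left hs]
        rcases le_total (s : ℝ) t' with hs' | hs'
        · rw [max_eq_right hs']
          exact intervalIntegral.integral_mono_interval hs hs' le_rfl
            (ae_of_all _ u.bound_nonneg) u.integrable_bound.intervalIntegrable
        · rw [max_eq_left hs', intervalIntegral.integral_same]
          exact intervalIntegral.integral_nonneg h' fun r _ => u.bound_nonneg r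
    intro t t'
    simp only [ContinuousMap.coe_mk]
    rcases le_total t t' with h | h
    · rw [norm_sub_rev]; exact key t t' h
    · rw [intervalIntegral.integral_symm (t' : ℝ), abs_neg]; exact key t' t h
  · ext1 t
    conv_lhs => rw [← (isSolutionFrom_iff _ _ _ _ _).mp h]
    rfl

/-- For noise paths in a compact set, the solutions started near `y` form a relatively compact
set. -/
theorem exists_isCompact_solutions (u : VelocityField d) (y : Space d) {K : Set (PathSpace d)}
    (hK : IsCompact K) : ∃ S : Set (PathSpace d), IsCompact S ∧
      ∀ (s : I) (x : Space d) (W X : PathSpace d), dist x y ≤ 1 → W ∈ K →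
        IsSolutionFrom u s x W X → X ∈ S := by
  refine ⟨shiftPath '' (Metric.closedBall y 1 ×ˢ Set.univ ×ˢ driftPaths u ×ˢ K),
    ((isCompact_closedBall y 1).prod (isCompact_univ.prod
      ((isCompact_driftPaths u).prod hK))).image continuous_shiftPath, fun s x W X hx hW h => ?_⟩
  obtain ⟨A, hA, rfl⟩ := h.exists_shiftPath
  exact ⟨(x, s, A, W), ⟨hx, trivial, hA, hW⟩, rfl⟩

/-! ### Nonanticipation and its stability under weak limits -/

instance instCompactSpaceIic (t : I) : CompactSpace (Set.Iic t) :=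
  isCompact_iff_compactSpace.mp isClosed_Iic.isCompact

/-- The conditional law of the noise given its past before time `t`. -/
def noiseKernel (𝕎 : ProbabilityMeasure (PathSpace d)) (t : I) :
    Kernel (PathSpaceUpTo d t) (PathSpace d) :=
  condDistrib (fun W : PathSpace d => W) (restr t) (𝕎 : Measure (PathSpace d))

instance instIsMarkovKernelNoiseKernel (𝕎 : ProbabilityMeasure (PathSpace d)) (t : I) :
    IsMarkovKernel (noiseKernel 𝕎 t) := by
  unfold noiseKernel; infer_instance

/-- The tested form of the conditional independence of `π^t X` and `W` given `π^t W`. -/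
def IsNonanticipating (𝕎 : ProbabilityMeasure (PathSpace d)) (𝕏 : Measure (PathSpace d × PathSpace d)) :
    Prop :=
  ∀ (t : I) (f : BoundedContinuousFunction (PathSpaceUpTo d t × PathSpaceUpTo d t) ℝ)
    (g : BoundedContinuousFunction (PathSpace d) ℝ),
    ∫ p, f (restr t p.2, restr t p.1) * g p.2 ∂𝕏 =
      ∫ p, f (restr t p.2, restr t p.1) * (∫ W, g W ∂(noiseKernel 𝕎 t (restr t p.2))) ∂𝕏

/-- Weak solutions with the tested form of nonanticipation. -/
structure IsTestedSolution (u : VelocityField d) (y : Space d)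
    (𝕎 : ProbabilityMeasure (PathSpace d))
    (𝕏 : ProbabilityMeasure (PathSpace d × PathSpace d)) : Prop where
  marginal : (𝕏 : Measure (PathSpace d × PathSpace d)).map Prod.snd = 𝕎
  nonanticipating : IsNonanticipating 𝕎 (𝕏 : Measure (PathSpace d × PathSpace d))
  solves : ∀ᵐ p ∂(𝕏 : Measure (PathSpace d × PathSpace d)), IsCaratheodorySolution u y p.2 p.1

/-- Conditional independence says that the law of `W` given `(π^t W, π^t X)` is the kernel given
`π^t W` alone. This is an equality of finite measures, hence determined by products of bounded
continuous test functions. -/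
theorem IsTestedSolution.isWeakSolution {u : VelocityField d} {y : Space d}
    {𝕎 : ProbabilityMeasure (PathSpace d)} {𝕏 : ProbabilityMeasure (PathSpace d × PathSpace d)}
    (h : IsTestedSolution u y 𝕎 𝕏) : IsWeakSolution u y 𝕎 𝕏 where
  marginal := h.marginal
  solves := h.solves
  nonanticipating t := by
    have hk : Measurable (fun p : PathSpace d × PathSpace d => restr t p.2) :=
      (measurable_restr t).comp measurable_snd
    have hg : Measurable (fun p : PathSpace d × PathSpace d => restr t p.1) :=
      (measurable_restr t).comp measurable_fst
    rw [condIndepFun_iff_condDistrib_prod_ae_eq_prodMkRight measurable_snd hg hk,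
      condDistrib_ae_eq_iff_measure_eq_compProd _ measurable_snd.aemeasurable]
    -- The kernel is built from the joint law of `(π^t W, W)`, which the noise marginal fixes, so
    -- the kernels agree exactly and not just almost everywhere.
    have hcond : condDistrib (fun p : PathSpace d × PathSpace d => p.2)
        (fun p : PathSpace d × PathSpace d => restr t p.2)
        (𝕏 : Measure (PathSpace d × PathSpace d)) = noiseKernel 𝕎 t := by
      have hmap : (𝕏 : Measure (PathSpace d × PathSpace d)).map (fun p => (restr t p.2, p.2)) =
          (𝕎 : Measure (PathSpace d)).map fun W => (restr t W, W) := by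
        rw [← h.marginal]
        exact (Measure.map_map (g := fun W => (restr t W, W))
          ((measurable_restr t).prodMk measurable_id) measurable_snd).symm
      rw [noiseKernel, condDistrib, condDistrib]
      simp_rw [hmap]
    rw [hcond]
    refine Measure.ext_of_integral_mul_boundedContinuousFunction fun f g => ?_
    rw [integral_map ((hk.prodMk hg).prodMk measurable_snd).aemeasurable
      (by fun_prop), Measure.integral_compProd, integral_map (hk.prodMk hg).aemeasurable]
    · simp only [Kernel.prodMkRight_apply, integral_const_mul]
      exact h.nonanticipating t f g
    · exact (StronglyMeasurable.integral_kernel_prod_right'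
        (f := fun z : (PathSpaceUpTo d t × PathSpaceUpTo d t) × PathSpace d => f z.1 * g z.2)
        (by fun_prop)).aestronglyMeasurable
    · refine Integrable.of_bound (C := ‖f‖ * ‖g‖) (by fun_prop) (ae_of_all _ fun z => ?_)
      rw [norm_mul]
      gcongr
      · exact f.norm_coe_le_norm _
      · exact g.norm_coe_le_norm _

theorem noiseKernel_compProd (𝕎 : ProbabilityMeasure (PathSpace d)) (t : I) :
    (𝕎 : Measure (PathSpace d)).map (restr t) ⊗ₘ noiseKernel 𝕎 t =
      (𝕎 : Measure (PathSpace d)).map fun W => (restr t W, W) :=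
  compProd_map_condDistrib measurable_id.aemeasurable

/-- Nonanticipation of strong solutions. -/
theorem isNonanticipating_of_adapted (𝕎 : ProbabilityMeasure (PathSpace d))
    {X : PathSpace d → PathSpace d} (hX : Measurable X)
    (hadapted : ∀ t W, restr t (X W) = restr t (X (extend t (restr t W)))) :
    IsNonanticipating 𝕎 ((𝕎 : Measure (PathSpace d)).map fun W => (X W, W)) := by
  intro t f g
  have hm : Measurable fun W => (X W, W) := hX.prodMk measurable_id
  have hr := measurable_restr (d := d) t
  have hh : Measurable fun w : PathSpaceUpTo d t => f (w, restr t (X (extend t w))) :=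
    f.continuous.measurable.comp (measurable_id.prodMk
      (hr.comp (hX.comp (continuous_extend t).measurable)))
  have hk : Measurable fun w : PathSpaceUpTo d t => ∫ W, g W ∂(noiseKernel 𝕎 t w) :=
    (StronglyMeasurable.integral_kernel_prod_right' (κ := noiseKernel 𝕎 t)
      (f := fun z : PathSpaceUpTo d t × PathSpace d => g z.2)
      (g.continuous.comp continuous_snd).stronglyMeasurable).measurable
  rw [integral_map hm.aemeasurable, integral_map hm.aemeasurable]
  · have e1 : ∀ W, f (restr t W, restr t (X W)) =
        (fun w : PathSpaceUpTo d t => f (w, restr t (X (extend t w)))) (restr t W) := fun W => by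
      simp only; rw [← hadapted]
    simp_rw [e1]
    set h := fun w : PathSpaceUpTo d t => f (w, restr t (X (extend t w)))
    have e2 : ∫ W, h (restr t W) * g W ∂(𝕎 : Measure (PathSpace d)) =
        ∫ z, h z.1 * g z.2 ∂((𝕎 : Measure (PathSpace d)).map fun W => (restr t W, W)) := by
      rw [integral_map (φ := fun W => (restr t W, W)) (hr.prodMk measurable_id).aemeasurable]
      exact ((hh.comp measurable_fst).mul
        (g.continuous.measurable.comp measurable_snd)).aestronglyMeasurable
    have e3 : ∫ W, h (restr t W) * (∫ W', g W' ∂(noiseKernel 𝕎 t (restr t W)))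
          ∂(𝕎 : Measure (PathSpace d)) =
        ∫ w, h w * (∫ W', g W' ∂(noiseKernel 𝕎 t w)) ∂((𝕎 : Measure (PathSpace d)).map (restr t)) := by
      rw [integral_map hr.aemeasurable]
      exact (hh.mul hk).aestronglyMeasurable
    rw [e2, e3, ← noiseKernel_compProd, Measure.integral_compProd]
    · simp only [integral_const_mul]
    · refine Integrable.of_bound (C := ‖f‖ * ‖g‖) ((hh.comp measurable_fst).mul
        (g.continuous.measurable.comp measurable_snd)).aestronglyMeasurable
        (ae_of_all _ fun z => ?_)
      rw [norm_mul]
      gcongr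
      · exact f.norm_coe_le_norm _
      · exact g.norm_coe_le_norm _
  · exact ((f.continuous.measurable.comp ((hr.comp measurable_snd).prodMk
      (hr.comp measurable_fst))).mul (hk.comp (hr.comp measurable_snd))).aestronglyMeasurable
  · exact ((f.continuous.measurable.comp ((hr.comp measurable_snd).prodMk
      (hr.comp measurable_fst))).mul
        (g.continuous.measurable.comp measurable_snd)).aestronglyMeasurable

/-- The only use of regular noise: with a continuous version of the noise kernel, both sides of the
tested identity are integrals of bounded continuous functions. -/
theorem isNonanticipating_of_tendsto {𝕎 : ProbabilityMeasure (PathSpace d)}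
    (h𝕎 : IsRegularNoise 𝕎) {ι : Type*} {l : Filter ι} [l.NeBot]
    {𝕏s : ι → ProbabilityMeasure (PathSpace d × PathSpace d)}
    {𝕏 : ProbabilityMeasure (PathSpace d × PathSpace d)} (hlim : Tendsto 𝕏s l (𝓝 𝕏))
    (hmarg : ∀ i, (𝕏s i : Measure (PathSpace d × PathSpace d)).map Prod.snd = 𝕎)
    (hmarg' : (𝕏 : Measure (PathSpace d × PathSpace d)).map Prod.snd = 𝕎)
    (h : ∀ i, IsNonanticipating 𝕎 (𝕏s i : Measure (PathSpace d × PathSpace d))) :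
    IsNonanticipating 𝕎 (𝕏 : Measure (PathSpace d × PathSpace d)) := by
  intro t f g
  obtain ⟨κ, hκ, hκ𝕎⟩ := h𝕎 t
  have hr := continuous_restr (d := d) t
  have hgκ : Continuous fun w => ∫ W, g W ∂(κ w : Measure (PathSpace d)) := by
    rw [continuous_iff_continuousAt]
    intro w
    exact ProbabilityMeasure.tendsto_iff_forall_integral_tendsto.mp (hκ.tendsto w) g
  have hbf : ∀ p : PathSpace d × PathSpace d, ‖f (restr t p.2, restr t p.1)‖ ≤ ‖f‖ := fun p =>
    f.norm_coe_le_norm _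
  let F₁ : BoundedContinuousFunction (PathSpace d × PathSpace d) ℝ :=
    BoundedContinuousFunction.ofNormedAddCommGroup
      (fun p => f (restr t p.2, restr t p.1) * g p.2) (by fun_prop) (‖f‖ * ‖g‖) fun p => by
        rw [norm_mul]
        gcongr
        · exact hbf p
        · exact g.norm_coe_le_norm _
  let F₂ : BoundedContinuousFunction (PathSpace d × PathSpace d) ℝ :=
    BoundedContinuousFunction.ofNormedAddCommGroup
      (fun p => f (restr t p.2, restr t p.1) * ∫ W, g W ∂(κ (restr t p.2) : Measure (PathSpace d)))
      (Continuous.mul (by fun_prop) (hgκ.comp (hr.comp continuous_snd))) (‖f‖ * ‖g‖) fun p => by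
        rw [norm_mul]
        gcongr
        · exact hbf p
        · exact g.norm_integral_le_norm _
  -- Replacing the kernel by `κ` costs nothing, because it changes only on a null set of noise paths
  -- and all the laws involved have noise marginal `𝕎`.
  have key : ∀ 𝕐 : ProbabilityMeasure (PathSpace d × PathSpace d),
      (𝕐 : Measure (PathSpace d × PathSpace d)).map Prod.snd = 𝕎 →
      ∫ p, f (restr t p.2, restr t p.1) * (∫ W, g W ∂(noiseKernel 𝕎 t (restr t p.2)))
        ∂(𝕐 : Measure (PathSpace d × PathSpace d)) = ∫ p, F₂ p ∂(𝕐 : Measure _) := by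
    intro 𝕐 h𝕐
    refine integral_congr_ae ?_
    have h1 : ∀ᵐ W ∂(𝕎 : Measure (PathSpace d)), noiseKernel 𝕎 t (restr t W) = κ (restr t W) :=
      ae_of_ae_map (measurable_restr t).aemeasurable hκ𝕎
    rw [← h𝕐] at h1
    filter_upwards [ae_of_ae_map measurable_snd.aemeasurable h1] with p hp
    rw [hp]; rfl
  rw [key 𝕏 hmarg']
  have h1 := ProbabilityMeasure.tendsto_iff_forall_integral_tendsto.mp hlim F₁
  have h2 := ProbabilityMeasure.tendsto_iff_forall_integral_tendsto.mp hlim F₂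
  refine tendsto_nhds_unique h1 (h2.congr fun i => ?_)
  rw [← key _ (hmarg i)]
  exact (h i t f g).symm

/-! ### Weak limits of laws of flows -/

/-- The law of the solution started from `x` at time `s > 0`, jointly with the noise. -/
def flowLaw (𝕎 : ProbabilityMeasure (PathSpace d)) (u : VelocityField d) {s : I} (hs : 0 < s)
    (x : Space d) : ProbabilityMeasure (PathSpace d × PathSpace d) :=
  𝕎.map (f := fun W => (flow s x u W, W))
    ((measurable_flow_noise hs x u).prodMk measurable_id).aemeasurable

theorem isTestedSolution_of_tendsto {𝕎 : ProbabilityMeasure (PathSpace d)}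
    (h𝕎 : IsRegularNoise 𝕎) (u : VelocityField d) {y : Space d} {s : ℕ → I} (hs : ∀ k, 0 < s k)
    (hs0 : Tendsto s atTop (𝓝 0)) {x : ℕ → Space d} (hx : Tendsto x atTop (𝓝 y))
    {l : Filter ℕ} [l.NeBot] (hl : l ≤ atTop)
    {𝕏 : ProbabilityMeasure (PathSpace d × PathSpace d)}
    (hlim : Tendsto (fun k => flowLaw 𝕎 u (hs k) (x k)) l (𝓝 𝕏)) :
    IsTestedSolution u y 𝕎 𝕏 := by
  have hm : ∀ k, Measurable fun W => (flow (s k) (x k) u W, W) := fun k =>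
    (measurable_flow_noise (hs k) (x k) u).prodMk measurable_id
  have hcoe : ∀ k, (flowLaw 𝕎 u (hs k) (x k) : Measure (PathSpace d × PathSpace d)) =
      (𝕎 : Measure (PathSpace d)).map fun W => (flow (s k) (x k) u W, W) := fun k => rfl
  have hmargs : ∀ k, (flowLaw 𝕎 u (hs k) (x k) : Measure (PathSpace d × PathSpace d)).map
      Prod.snd = 𝕎 := fun k => by
    rw [hcoe, Measure.map_map measurable_snd (hm k)]
    exact Measure.map_id
  have hmarg : (𝕏 : Measure (PathSpace d × PathSpace d)).map Prod.snd = 𝕎 := by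
    have h1 := ProbabilityMeasure.tendsto_map_of_tendsto_of_continuous _ _ hlim
      (continuous_snd (X := PathSpace d) (Y := PathSpace d))
    have h2 : Tendsto (fun _ : ℕ => 𝕎) l (𝓝 𝕎) := tendsto_const_nhds
    have h3 : 𝕏.map (measurable_snd (α := PathSpace d) (β := PathSpace d)).aemeasurable = 𝕎 :=
      tendsto_nhds_unique h1 (h2.congr fun k => Subtype.ext (hmargs k).symm)
    exact congrArg Subtype.val h3
  refine ⟨hmarg, isNonanticipating_of_tendsto h𝕎 hlim hmargs hmarg fun k => ?_, ?_⟩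
  · rw [hcoe]
    exact isNonanticipating_of_adapted 𝕎 (measurable_flow_noise (hs k) (x k) u) fun t W =>
      restr_flow (hs k) (x k) u W t
  -- Each tail set of solutions carries full mass eventually, so by the portmanteau theorem its
  -- closure has full `𝕏` mass. A point in all these closures is a limit of solutions whose starting
  -- times tend to zero.
  · let S : ℕ → Set (PathSpace d × PathSpace d) := fun n =>
      {p | ∃ k, n ≤ k ∧ IsSolutionFrom u (s k) (x k) p.2 p.1}
    have hS : ∀ n, ∀ᵐ p ∂(𝕏 : Measure (PathSpace d × PathSpace d)), p ∈ closure (S n) := by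
      intro n
      have h1 := ProbabilityMeasure.limsup_measure_closed_le_of_tendsto hlim
        (isClosed_closure (s := S n))
      have h2 : ∀ᶠ k in l, (flowLaw 𝕎 u (hs k) (x k) : Measure (PathSpace d × PathSpace d))
          (closure (S n)) = 1 := by
        filter_upwards [hl (eventually_ge_atTop n)] with k hk
        rw [hcoe, Measure.map_apply (hm k) isClosed_closure.measurableSet]
        have : (fun W => (flow (s k) (x k) u W, W)) ⁻¹' closure (S n) = Set.univ := by
          refine Set.eq_univ_of_forall fun W => subset_closure ⟨k, hk, ?_⟩
          exact isSolutionFrom_flow (hs k) (x k) u W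
        rw [this, measure_univ]
      rw [limsup_congr h2, limsup_const] at h1
      exact (prob_compl_eq_zero_iff isClosed_closure.measurableSet).mpr
        (le_antisymm prob_le_one h1)
    filter_upwards [ae_all_iff.mpr hS] with p hp
    have hseq : ∀ n : ℕ, ∃ k, ∃ q : PathSpace d × PathSpace d, n ≤ k ∧
        IsSolutionFrom u (s k) (x k) q.2 q.1 ∧ dist p q < 1 / ((n : ℝ) + 1) := fun n => by
      obtain ⟨q, ⟨k, hk, hq⟩, hd⟩ := Metric.mem_closure_iff.mp (hp n) _
        (Nat.one_div_pos_of_nat (α := ℝ) (n := n))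
      exact ⟨k, q, hk, hq, hd⟩
    choose k q hk hq hd using hseq
    have hqp : Tendsto q atTop (𝓝 p) := by
      rw [tendsto_iff_dist_tendsto_zero]
      refine squeeze_zero (fun _ => dist_nonneg) (fun n => ?_)
        tendsto_one_div_add_atTop_nhds_zero_nat
      rw [dist_comm]; exact (hd n).le
    have hk' : Tendsto k atTop atTop := tendsto_atTop_mono hk tendsto_id
    exact isCaratheodorySolution_of_tendsto (hs0.comp hk') (hx.comp hk')
      ((continuous_snd.tendsto p).comp hqp) ((continuous_fst.tendsto p).comp hqp) hq

/-- The joint law of two solutions started at time `s > 0`, together with the noise. -/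
def flowPairLaw (𝕎 : ProbabilityMeasure (PathSpace d)) (u : VelocityField d) {s : I} (hs : 0 < s)
    (x z : Space d) : ProbabilityMeasure (PathSpace d × PathSpace d × PathSpace d) :=
  𝕎.map (f := fun W => (flow s x u W, flow s z u W, W))
    ((measurable_flow_noise hs x u).prodMk
      ((measurable_flow_noise hs z u).prodMk measurable_id)).aemeasurable

/-- Limits of pairs of solutions started at small times are couplings of weak solutions. -/
theorem exists_coupling {𝕎 : ProbabilityMeasure (PathSpace d)}
    (h𝕎 : IsRegularNoise 𝕎) (u : VelocityField d) {y : Space d} {s : ℕ → I} (hs : ∀ k, 0 < s k)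
    (hs0 : Tendsto s atTop (𝓝 0)) {x z : ℕ → Space d} (hx : Tendsto x atTop (𝓝 y))
    (hz : Tendsto z atTop (𝓝 y)) {l : Filter ℕ} [l.NeBot] (hl : l ≤ atTop) :
    ∃ 𝕐 : ProbabilityMeasure (PathSpace d × PathSpace d × PathSpace d),
      IsTestedSolution u y 𝕎 (𝕐.map (f := fun p => (p.1, p.2.2)) (by fun_prop)) ∧
      IsTestedSolution u y 𝕎 (𝕐.map (f := fun p => (p.2.1, p.2.2)) (by fun_prop)) ∧
      ∀ (O : Set (PathSpace d × PathSpace d × PathSpace d)) (c : ℝ≥0∞), IsOpen O →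
        (∀ᶠ k in l, (flowPairLaw 𝕎 u (hs k) (x k) (z k) :
          Measure (PathSpace d × PathSpace d × PathSpace d)) O ≤ c) →
        (𝕐 : Measure (PathSpace d × PathSpace d × PathSpace d)) O ≤ c := by
  let 𝕐s := fun k => flowPairLaw 𝕎 u (hs k) (x k) (z k)
  have hm : ∀ k, Measurable fun W => (flow (s k) (x k) u W, flow (s k) (z k) u W, W) := fun k =>
    (measurable_flow_noise (hs k) (x k) u).prodMk
      ((measurable_flow_noise (hs k) (z k) u).prodMk measurable_id)
  have hcoe : ∀ k, (𝕐s k : Measure (PathSpace d × PathSpace d × PathSpace d)) =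
      (𝕎 : Measure (PathSpace d)).map
        fun W => (flow (s k) (x k) u W, flow (s k) (z k) u W, W) := fun k => rfl
  let G : Set ℕ := {k | dist (x k) y ≤ 1 ∧ dist (z k) y ≤ 1}
  have hG : ∀ᶠ k in atTop, k ∈ G := by
    have h1 := (tendsto_iff_dist_tendsto_zero.mp hx).eventually_le_const one_pos
    have h2 := (tendsto_iff_dist_tendsto_zero.mp hz).eventually_le_const one_pos
    exact h1.and h2
  -- Tightness reduces to that of the single law `𝕎`: over a compact set of noise paths, all
  -- solutions started within distance one of `y` lie in a common compact set.
  have htight : IsTightMeasureSet {((μ : ProbabilityMeasure (PathSpace d × PathSpace d × PathSpace d)) :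
      Measure (PathSpace d × PathSpace d × PathSpace d)) | μ ∈ 𝕐s '' G} := by
    rw [isTightMeasureSet_iff_exists_isCompact_measure_compl_le]
    intro ε hε
    obtain ⟨K, hK, hKε⟩ := isTightMeasureSet_iff_exists_isCompact_measure_compl_le.mp
      (isTightMeasureSet_singleton (μ := (𝕎 : Measure (PathSpace d)))) ε hε
    obtain ⟨S, hS, hSsol⟩ := exists_isCompact_solutions u y hK
    refine ⟨S ×ˢ S ×ˢ K, hS.prod (hS.prod hK), ?_⟩
    rintro _ ⟨_, ⟨k, hk, rfl⟩, rfl⟩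
    rw [hcoe, Measure.map_apply (hm k) (hS.prod (hS.prod hK)).isClosed.measurableSet.compl]
    have hsub : (fun W => (flow (s k) (x k) u W, flow (s k) (z k) u W, W)) ⁻¹' (S ×ˢ S ×ˢ K)ᶜ ⊆
        Kᶜ := fun W hW hWK => hW
      ⟨hSsol _ _ _ _ hk.1 hWK (isSolutionFrom_flow (hs k) (x k) u W),
        hSsol _ _ _ _ hk.2 hWK (isSolutionFrom_flow (hs k) (z k) u W), hWK⟩
    exact (measure_mono hsub).trans (hKε _ rfl)
  have hcpt := isCompact_closure_of_isTightMeasureSet htight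
  -- An ultrafilter finer than `l` replaces the choice of a convergent subsequence and retains every
  -- property that holds eventually along `l`.
  let 𝒢 := Ultrafilter.of l
  have h𝒢l : (𝒢 : Filter ℕ) ≤ l := Ultrafilter.of_le l
  have h𝒢 : (𝒢 : Filter ℕ) ≤ atTop := h𝒢l.trans hl
  obtain ⟨𝕐, -, h𝕐⟩ := hcpt.ultrafilter_le_nhds (𝒢.map 𝕐s) (by
    rw [le_principal_iff]
    change 𝕐s ⁻¹' _ ∈ (𝒢 : Filter ℕ)
    filter_upwards [h𝒢 hG] with k hk using subset_closure ⟨k, hk, rfl⟩)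
  have hlim : Tendsto 𝕐s 𝒢 (𝓝 𝕐) := h𝕐
  refine ⟨𝕐, ?_, ?_, fun O c hO hc => ?_⟩
  · refine isTestedSolution_of_tendsto h𝕎 u hs hs0 hx h𝒢 ?_
    have h1 := ProbabilityMeasure.tendsto_map_of_tendsto_of_continuous _ _ hlim
      (f := fun p : PathSpace d × PathSpace d × PathSpace d => (p.1, p.2.2)) (by fun_prop)
    refine h1.congr fun k => Subtype.ext ?_
    exact Measure.map_map (f := fun W => (flow (s k) (x k) u W, flow (s k) (z k) u W, W))
      (by fun_prop) (hm k)
  · refine isTestedSolution_of_tendsto h𝕎 u hs hs0 hz h𝒢 ?_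
    have h1 := ProbabilityMeasure.tendsto_map_of_tendsto_of_continuous _ _ hlim
      (f := fun p : PathSpace d × PathSpace d × PathSpace d => (p.2.1, p.2.2)) (by fun_prop)
    refine h1.congr fun k => Subtype.ext ?_
    exact Measure.map_map (f := fun W => (flow (s k) (x k) u W, flow (s k) (z k) u W, W))
      (by fun_prop) (hm k)
  · refine (ProbabilityMeasure.le_liminf_measure_open_of_tendsto hlim hO).trans ?_
    exact (liminf_le_limsup).trans (limsup_le_of_le (by isBoundedDefault) (h𝒢l hc))

/-! ### Choice of separating starting points and times -/

theorem limsup_lintegral_le_of_le_one {Ω : Type*} [MeasurableSpace Ω] {μ : Measure Ω}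
    [IsProbabilityMeasure μ] {f : ℕ → Ω → ℝ≥0∞} (hf : ∀ n, Measurable (f n))
    (h1 : ∀ n o, f n o ≤ 1) :
    limsup (fun n => ∫⁻ o, f n o ∂μ) atTop ≤ ∫⁻ o, limsup (fun n => f n o) atTop ∂μ :=
  limsup_lintegral_le (fun _ => 1) hf (fun n => ae_of_all _ (h1 n)) (by simp)

theorem limsup_le_one {ι : Type*} {l : Filter ι} {f : ι → ℝ≥0∞} (h : ∀ i, f i ≤ 1) :
    limsup f l ≤ 1 :=
  limsup_le_of_le (by isBoundedDefault) (Eventually.of_forall h)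

theorem limsup_comp_le {ι κ : Type*} {l : Filter ι} {l' : Filter κ} {f : κ → ℝ≥0∞} {φ : ι → κ}
    (hφ : Tendsto φ l l') : limsup (fun i => f (φ i)) l ≤ limsup f l' := by
  change limsup (f ∘ φ) l ≤ _
  rw [limsup, ← Filter.map_map]
  exact limsSup_le_limsSup_of_le (Filter.map_mono hφ)

theorem limsup_limsup_comp_le {ι κ α β : Type*} {l : Filter ι} {l' : Filter κ} {m : Filter α}
    {m' : Filter β} (f : α → β → ℝ≥0∞) {φ : ι → α} {ψ : κ → β} (hφ : Tendsto φ l m)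
    (hψ : Tendsto ψ l' m') :
    limsup (fun i => limsup (fun k => f (φ i) (ψ k)) l') l ≤
      limsup (fun a => limsup (fun b => f a b) m') m :=
  (limsup_le_limsup (Eventually.of_forall fun _ => limsup_comp_le hψ) (by isBoundedDefault)
    (by isBoundedDefault)).trans (limsup_comp_le (f := fun a => limsup (fun b => f a b) m') hφ)

/-- A sequential form of the Borel-Cantelli lemma for lower limits. -/
theorem ae_tendsto_liminf_zero {Ω : Type*} [MeasurableSpace Ω] {μ : Measure Ω}
    {f : ℕ → ℕ → Ω → ℝ≥0∞} (hf : ∀ j k, Measurable (f j k))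
    (h : ∀ j, ∀ᶠ k in atTop, ∫⁻ o, f j k o ∂μ ≤ (2⁻¹ : ℝ≥0∞) ^ j) :
    ∀ᵐ o ∂μ, Tendsto (fun j => liminf (fun k => f j k o) atTop) atTop (𝓝 0) := by
  have hm : ∀ j, Measurable fun o => liminf (fun k => f j k o) atTop := fun j =>
    Measurable.liminf (hf j)
  -- Fatou's lemma controls only the lower limit in `k`; later subsequences therefore depend on the
  -- sample point.
  have hle : ∀ j, ∫⁻ o, liminf (fun k => f j k o) atTop ∂μ ≤ (2⁻¹ : ℝ≥0∞) ^ j := fun j =>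
    (lintegral_liminf_le (hf j)).trans
      (liminf_le_of_frequently_le' (h j).frequently)
  have hsum : ∫⁻ o, ∑' j, liminf (fun k => f j k o) atTop ∂μ ≠ ⊤ := by
    rw [lintegral_tsum fun j => (hm j).aemeasurable]
    refine ne_top_of_le_ne_top ?_ (ENNReal.tsum_le_tsum hle)
    rw [ENNReal.tsum_geometric, ENNReal.one_sub_inv_two, inv_inv]
    exact ENNReal.ofNat_ne_top
  filter_upwards [ae_lt_top (Measurable.tsum hm) hsum] with o ho
  exact ENNReal.tendsto_atTop_zero_of_tsum_ne_top ho.ne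

/-- The event that the solutions started at time `s` from `x` and `z` are `δ`-close at time `t`. -/
def closeEvent (s t : I) (δ : ℝ) (x z : Space d) : Set (VelocityField d × PathSpace d) :=
  {p | dist (flow s x p.1 p.2 t) (flow s z p.1 p.2 t) < δ}

theorem measurableSet_closeEvent {s : I} (hs : 0 < s) (t : I) (δ : ℝ) (x z : Space d) :
    MeasurableSet (closeEvent s t δ x z) :=
  measurableSet_lt (((measurable_eval_path t).comp (measurable_flow hs x)).dist
    ((measurable_eval_path t).comp (measurable_flow hs z))) measurable_const

section Separation

variable {𝕎 : ProbabilityMeasure (PathSpace d)} {𝕌 : ProbabilityMeasure (VelocityField d)}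
  {T : ℕ → I}

theorem ExplosivelySeparating.tendsto_seq {W : PathSpace d}
    (hW : ExplosivelySeparating 𝕌 T W) {y : Space d} {z : ℕ → Space d}
    (hz : Tendsto z atTop (𝓝 y)) (hzy : ∀ k, z k ≠ y) {δ : ℕ → ℝ}
    (hδ : Tendsto δ atTop (𝓝[>] 0)) :
    Tendsto (fun n => limsup (fun i => limsup (fun k => limsup (fun m =>
      (𝕌 : Measure (VelocityField d))
        {u | dist (flow (T m) y u W (T n)) (flow (T m) (z k) u W (T n)) < δ i})
      atTop) atTop) atTop) atTop (𝓝 0) := by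
  have hzc : Tendsto (fun k => (y, z k)) atTop
      (comap (fun p : Space d × Space d => dist p.1 p.2) (𝓝[>] 0)) := by
    rw [tendsto_comap_iff]
    refine tendsto_nhdsWithin_iff.mpr ⟨?_, Eventually.of_forall fun k => ?_⟩
    · have := tendsto_iff_dist_tendsto_zero.mp hz
      simpa [Function.comp_def, dist_comm] using this
    · exact dist_pos.mpr (hzy k).symm
  unfold ExplosivelySeparating at hW
  refine tendsto_of_tendsto_of_tendsto_of_le_of_le tendsto_const_nhds hW (fun _ => zero_le) ?_
  intro n
  have h := limsup_limsup_comp_le (fun (δ : ℝ) (p : Space d × Space d) =>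
    limsup (fun m : ℕ => (𝕌 : Measure (VelocityField d))
      {u | dist (flow (T m) p.1 u W (T n)) (flow (T m) p.2 u W (T n)) < δ}) atTop) hδ hzc
  beta_reduce at h ⊢
  exact h

/-- Integration over the noise: reverse Fatou, with dominating constant one, moves the integral
inside each upper limit in turn. The filters in `δ` and in the pair of points have been replaced by
sequences so that this applies. -/
theorem tendsto_limsup_prod_closeEvent (hTpos : ∀ n, 0 < T n)
    (hsep : ∀ᵐ W ∂(𝕎 : Measure (PathSpace d)), ExplosivelySeparating 𝕌 T W)
    {y : Space d} {z : ℕ → Space d} (hz : Tendsto z atTop (𝓝 y)) (hzy : ∀ k, z k ≠ y)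
    {δ : ℕ → ℝ} (hδ : Tendsto δ atTop (𝓝[>] 0)) :
    Tendsto (fun n => limsup (fun i => limsup (fun k => limsup (fun m =>
      (𝕌 : Measure (VelocityField d)).prod (𝕎 : Measure (PathSpace d))
        (closeEvent (T m) (T n) (δ i) y (z k))) atTop) atTop) atTop) atTop (𝓝 0) := by
  let a : ℕ → ℕ → ℕ → ℕ → PathSpace d → ℝ≥0∞ := fun n i k m W =>
    (𝕌 : Measure (VelocityField d))
      {u | dist (flow (T m) y u W (T n)) (flow (T m) (z k) u W (T n)) < δ i}
  have hE : ∀ n i k m, MeasurableSet (closeEvent (T m) (T n) (δ i) y (z k)) := fun n i k m =>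
    measurableSet_closeEvent (hTpos m) _ _ _ _
  have ha : ∀ n i k m, Measurable (a n i k m) := fun n i k m =>
    measurable_measure_prodMk_right (hE n i k m)
  have ha1 : ∀ n i k m W, a n i k m W ≤ 1 := fun n i k m W => prob_le_one
  have hprod : ∀ n i k m, (𝕌 : Measure (VelocityField d)).prod (𝕎 : Measure (PathSpace d))
      (closeEvent (T m) (T n) (δ i) y (z k)) = ∫⁻ W, a n i k m W ∂(𝕎 : Measure (PathSpace d)) :=
    fun n i k m => Measure.prod_apply_symm (hE n i k m)
  simp_rw [hprod]
  let b := fun n i k W => limsup (fun m => a n i k m W) atTop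
  let c := fun n i W => limsup (fun k => b n i k W) atTop
  let e := fun n W => limsup (fun i => c n i W) atTop
  have hb : ∀ n i k, Measurable (b n i k) := fun n i k => Measurable.limsup (ha n i k)
  have hc : ∀ n i, Measurable (c n i) := fun n i => Measurable.limsup (hb n i)
  have he : ∀ n, Measurable (e n) := fun n => Measurable.limsup (hc n)
  have hb1 : ∀ n i k W, b n i k W ≤ 1 := fun n i k W => limsup_le_one fun m => ha1 n i k m W
  have hc1 : ∀ n i W, c n i W ≤ 1 := fun n i W => limsup_le_one fun k => hb1 n i k W
  have he1 : ∀ n W, e n W ≤ 1 := fun n W => limsup_le_one fun i => hc1 n i W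
  have hlim : ∀ᵐ W ∂(𝕎 : Measure (PathSpace d)), Tendsto (fun n => e n W) atTop (𝓝 0) := by
    filter_upwards [hsep] with W hW using hW.tendsto_seq hz hzy hδ
  have hint : Tendsto (fun n => ∫⁻ W, e n W ∂(𝕎 : Measure (PathSpace d))) atTop (𝓝 0) := by
    have := tendsto_lintegral_of_dominated_convergence (μ := (𝕎 : Measure (PathSpace d)))
      (F := e) (f := fun _ => 0) (fun _ => 1) he (fun n => ae_of_all _ (he1 n)) (by simp) hlim
    simpa using this
  refine tendsto_of_tendsto_of_tendsto_of_le_of_le tendsto_const_nhds hint (fun _ => zero_le)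
    fun n => ?_
  refine le_trans ?_ (limsup_lintegral_le_of_le_one (hc n) (hc1 n))
  refine limsup_le_limsup (Eventually.of_forall fun i => ?_) (by isBoundedDefault)
    (by isBoundedDefault)
  refine le_trans ?_ (limsup_lintegral_le_of_le_one (hb n i) (hb1 n i))
  refine limsup_le_limsup (Eventually.of_forall fun k => ?_) (by isBoundedDefault)
    (by isBoundedDefault)
  exact limsup_lintegral_le_of_le_one (ha n i k) (ha1 n i k)

/-- A diagonal choice of times along which solutions started nearby separate. -/
theorem exists_separating_sequences (hd : 1 ≤ d) (hTpos : ∀ n, 0 < T n)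
    (hsep : ∀ᵐ W ∂(𝕎 : Measure (PathSpace d)), ExplosivelySeparating 𝕌 T W) (y : Space d) :
    ∃ (z : ℕ → Space d) (N M : ℕ → ℕ) (δ : ℕ → ℝ), Tendsto z atTop (𝓝 y) ∧ Tendsto N atTop atTop ∧
      Tendsto M atTop atTop ∧ (∀ j, 0 < δ j) ∧
      ∀ j, ∀ᶠ k in atTop, (𝕌 : Measure (VelocityField d)).prod (𝕎 : Measure (PathSpace d))
        (closeEvent (T (M k)) (T (N j)) (δ j) y (z k)) ≤ (2⁻¹ : ℝ≥0∞) ^ j := by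
  let e : Space d := EuclideanSpace.single ⟨0, hd⟩ 1
  have he : e ≠ 0 := by
    intro h
    have : ‖e‖ = 1 := by simp [e]
    rw [h, norm_zero] at this
    exact zero_ne_one this
  let z : ℕ → Space d := fun k => y + (1 / ((k : ℝ) + 1)) • e
  have hz : Tendsto z atTop (𝓝 y) := by
    have := ((tendsto_one_div_add_atTop_nhds_zero_nat (𝕜 := ℝ)).smul_const e).const_add y
    rwa [zero_smul, add_zero] at this
  have hzy : ∀ k, z k ≠ y := fun k => by
    have : (1 / ((k : ℝ) + 1)) ≠ 0 := by positivity
    simp only [z, ne_eq, add_eq_left, smul_eq_zero, not_or]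
    exact ⟨this, he⟩
  let δ : ℕ → ℝ := fun i => 1 / ((i : ℝ) + 1)
  have hδpos : ∀ i, 0 < δ i := fun i => Nat.one_div_pos_of_nat
  have hδ : Tendsto δ atTop (𝓝[>] 0) := tendsto_nhdsWithin_iff.mpr
    ⟨tendsto_one_div_add_atTop_nhds_zero_nat, Eventually.of_forall hδpos⟩
  have hlim := tendsto_limsup_prod_closeEvent hTpos hsep hz hzy hδ
  let P : ℕ → ℕ → ℕ → ℕ → ℝ≥0∞ := fun n i k m =>
    (𝕌 : Measure (VelocityField d)).prod (𝕎 : Measure (PathSpace d))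
        (closeEvent (T m) (T n) (δ i) y (z k))
  have h1 : ∀ j : ℕ, ∃ n i, j ≤ n ∧ ∀ᶠ k in atTop, ∀ᶠ m in atTop, P n i k m < (2⁻¹ : ℝ≥0∞) ^ j := by
    intro j
    have hpos : (0 : ℝ≥0∞) < 2⁻¹ ^ j := ENNReal.pow_pos (by simp) j
    obtain ⟨n, hn, hjn⟩ := ((hlim.eventually_lt_const hpos).and (eventually_ge_atTop j)).exists
    obtain ⟨i, hi⟩ := (eventually_lt_of_limsup_lt hn).exists
    refine ⟨n, i, hjn, ?_⟩
    filter_upwards [eventually_lt_of_limsup_lt hi] with k hk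
    exact eventually_lt_of_limsup_lt hk
  choose N i hN hNi using h1
  -- Diagonal argument: one `m` serves all `j ≤ k` at once. The requirement is conditional because,
  -- for a given `j`, the inner bound is only known for large `k`.
  have h2 : ∀ k : ℕ, ∃ m, k ≤ m ∧ ∀ j ∈ Finset.range (k + 1),
      (∀ᶠ m in atTop, P (N j) (i j) k m < (2⁻¹ : ℝ≥0∞) ^ j) →
        P (N j) (i j) k m < (2⁻¹ : ℝ≥0∞) ^ j := by
    intro k
    refine ((eventually_ge_atTop k).and ((Finset.eventually_all _).mpr fun j _ => ?_)).exists
    by_cases h : ∀ᶠ m in atTop, P (N j) (i j) k m < (2⁻¹ : ℝ≥0∞) ^ j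
    · filter_upwards [h] with m hm _ using hm
    · exact Eventually.of_forall fun m h' => absurd h' h
  choose M hM hMP using h2
  refine ⟨z, N, M, fun j => δ (i j), hz, tendsto_atTop_mono hN tendsto_id,
    tendsto_atTop_mono hM tendsto_id, fun j => hδpos _, fun j => ?_⟩
  filter_upwards [hNi j, eventually_ge_atTop j] with k hk hjk
  exact (hMP k j (Finset.mem_range.mpr (Nat.lt_succ_of_le hjk)) hk).le

theorem restr_ne_of_dist_pos {ε t : I} (ht : t ≤ ε) {X Y : PathSpace d}
    (h : 0 < dist (X t) (Y t)) : restr ε X ≠ restr ε Y := by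
  intro he
  have : X t = Y t := DFunLike.congr_fun he (⟨t, ht⟩ : Set.Iic ε)
  rw [this, dist_self] at h
  exact lt_irrefl _ h

/-- For almost every velocity field there are couplings of weak solutions which are unlikely to
coincide near time zero. -/
theorem ae_exists_coupling_coincidence_le (hd : 1 ≤ d) (h𝕎 : IsRegularNoise 𝕎)
    (hTpos : ∀ n, 0 < T n) (hT : Tendsto T atTop (𝓝 0))
    (hsep : ∀ᵐ W ∂(𝕎 : Measure (PathSpace d)), ExplosivelySeparating 𝕌 T W) (y : Space d) :
    ∀ᵐ u ∂(𝕌 : Measure (VelocityField d)), ∀ ε : I, 0 < ε → ∀ γ : ℝ≥0∞, 0 < γ →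
      ∃ 𝕐 : ProbabilityMeasure (PathSpace d × PathSpace d × PathSpace d),
        IsTestedSolution u y 𝕎 (𝕐.map (f := fun p => (p.1, p.2.2)) (by fun_prop)) ∧
        IsTestedSolution u y 𝕎 (𝕐.map (f := fun p => (p.2.1, p.2.2)) (by fun_prop)) ∧
        (𝕐 : Measure (PathSpace d × PathSpace d × PathSpace d)) (coincidence d ε) ≤ γ := by
  obtain ⟨z, N, M, δ, hz, hN, hM, hδ, hP⟩ := exists_separating_sequences hd hTpos hsep y
  have hE : ∀ j k, MeasurableSet (closeEvent (T (M k)) (T (N j)) (δ j) y (z k)) := fun j k =>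
    measurableSet_closeEvent (hTpos _) _ _ _ _
  have hae := ae_tendsto_liminf_zero (μ := (𝕌 : Measure (VelocityField d)))
    (f := fun j k u => (𝕎 : Measure (PathSpace d))
      (Prod.mk u ⁻¹' closeEvent (T (M k)) (T (N j)) (δ j) y (z k)))
    (fun j k => measurable_measure_prodMk_left (hE j k)) (fun j => by
      filter_upwards [hP j] with k hk
      rwa [Measure.prod_apply (hE j k)] at hk)
  filter_upwards [hae] with u hu ε hε γ hγ
  have hTN : Tendsto (fun j => T (N j)) atTop (𝓝 0) := hT.comp hN
  obtain ⟨j, hj, hjε⟩ := ((hu.eventually_lt_const hγ).and (hTN.eventually_le_const hε)).exists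
  have hfreq := frequently_lt_of_liminf_lt (by isBoundedDefault) hj
  -- The indices at which the pair is unlikely to be close at time `T (N j)`. They are frequent, as
  -- the lower limit is below `γ`.
  let l : Filter ℕ := atTop ⊓ 𝓟 {k | (𝕎 : Measure (PathSpace d))
      (Prod.mk u ⁻¹' closeEvent (T (M k)) (T (N j)) (δ j) y (z k)) < γ}
  have : l.NeBot := frequently_mem_iff_neBot.mp hfreq
  obtain ⟨𝕐, h1, h2, hO⟩ := exists_coupling h𝕎 u (s := fun k => T (M k)) (fun k => hTpos _)
    (hT.comp hM) (x := fun _ => y) tendsto_const_nhds hz (l := l) inf_le_left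
  refine ⟨𝕐, h1, h2, ?_⟩
  let O : Set (PathSpace d × PathSpace d × PathSpace d) :=
    {p | dist (p.1 (T (N j))) (p.2.1 (T (N j))) < δ j}
  have hOo : IsOpen O := isOpen_lt (by fun_prop) continuous_const
  have hle := hO O γ hOo (by
    refine mem_inf_of_right fun k hk => ?_
    refine le_trans (le_of_eq ?_) (le_of_lt (Set.mem_ofPred_eq ▸ hk))
    exact Measure.map_apply ((measurable_flow_noise (hTpos _) y u).prodMk
      ((measurable_flow_noise (hTpos _) (z k) u).prodMk measurable_id)) hOo.measurableSet)
  -- Coincidence up to `ε` forces closeness at `T (N j) ≤ ε`, and closeness is an open event, so its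
  -- bound survives the weak limit.
  refine (measure_mono fun p hp => ?_).trans hle
  by_contra hpO
  exact restr_ne_of_dist_pos hjε ((hδ j).trans_le (not_lt.mp hpO)) hp

/-- Pathwise nonuniqueness of Carathéodory solutions. -/
theorem ae_exists_two_solutions (hd : 1 ≤ d) (hTpos : ∀ n, 0 < T n) (hT : Tendsto T atTop (𝓝 0))
    (hsep : ∀ᵐ W ∂(𝕎 : Measure (PathSpace d)), ExplosivelySeparating 𝕌 T W) (y : Space d) :
    ∀ᵐ q ∂((𝕌 : Measure (VelocityField d)).prod (𝕎 : Measure (PathSpace d))),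
      ∀ ε : I, 0 < ε → ∃ X₁ X₂ : PathSpace d, IsCaratheodorySolution q.1 y q.2 X₁ ∧
        IsCaratheodorySolution q.1 y q.2 X₂ ∧ restr ε X₁ ≠ restr ε X₂ := by
  obtain ⟨z, N, M, δ, hz, hN, hM, hδ, hP⟩ := exists_separating_sequences hd hTpos hsep y
  have hE : ∀ j k, MeasurableSet (closeEvent (T (M k)) (T (N j)) (δ j) y (z k)) := fun j k =>
    measurableSet_closeEvent (hTpos _) _ _ _ _
  have hae := ae_tendsto_liminf_zero
    (μ := (𝕌 : Measure (VelocityField d)).prod (𝕎 : Measure (PathSpace d)))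
    (f := fun j k => (closeEvent (T (M k)) (T (N j)) (δ j) y (z k)).indicator 1)
    (fun j k => measurable_one.indicator (hE j k)) (fun j => by
      filter_upwards [hP j] with k hk
      rwa [lintegral_indicator_one (hE j k)])
  filter_upwards [hae] with q hq ε hε
  have hTN : Tendsto (fun j => T (N j)) atTop (𝓝 0) := hT.comp hN
  obtain ⟨j, hj, hjε⟩ := ((hq.eventually_lt_const one_pos).and (hTN.eventually_le_const hε)).exists
  -- An indicator below one is zero: infinitely often the two solutions are at least `δ j` apart.
  have hfreq := frequently_lt_of_liminf_lt (by isBoundedDefault) hj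
  have hfreq' := hfreq.and_eventually
    ((tendsto_iff_dist_tendsto_zero.mp hz).eventually_le_const one_pos)
  obtain ⟨φ, hφ, hφP⟩ := extraction_of_frequently_atTop hfreq'
  obtain ⟨S, hS, hSsol⟩ := exists_isCompact_solutions q.1 y (isCompact_singleton (x := q.2))
  have hflow := fun (k : ℕ) (x : Space d) => isSolutionFrom_flow (hTpos (M k)) x q.1 q.2
  obtain ⟨⟨X₁, X₂⟩, -, ψ, hψ, hlim⟩ := (hS.prod hS).tendsto_subseq
    (x := fun k => (flow (T (M (φ k))) y q.1 q.2, flow (T (M (φ k))) (z (φ k)) q.1 q.2))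
    fun k => ⟨hSsol _ _ _ _ (by simp) rfl (hflow _ _), hSsol _ _ _ _ (hφP k).2 rfl (hflow _ _)⟩
  have hφψ : Tendsto (fun k => φ (ψ k)) atTop atTop := hφ.tendsto_atTop.comp hψ.tendsto_atTop
  have hs0 : Tendsto (fun k => T (M (φ (ψ k)))) atTop (𝓝 0) := hT.comp (hM.comp hφψ)
  have hX₁ := (continuous_fst.tendsto (X₁, X₂)).comp hlim
  have hX₂ := (continuous_snd.tendsto (X₁, X₂)).comp hlim
  refine ⟨X₁, X₂, ?_, ?_, restr_ne_of_dist_pos hjε ((hδ j).trans_le ?_)⟩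
  · exact isCaratheodorySolution_of_tendsto hs0 (x := fun _ => y) tendsto_const_nhds
      tendsto_const_nhds hX₁ fun k => hflow _ _
  · exact isCaratheodorySolution_of_tendsto hs0 (hz.comp hφψ)
      tendsto_const_nhds hX₂ fun k => hflow _ _
  · have hc : Tendsto (fun k => dist (flow (T (M (φ (ψ k)))) y q.1 q.2 (T (N j)))
        (flow (T (M (φ (ψ k)))) (z (φ (ψ k))) q.1 q.2 (T (N j)))) atTop
        (𝓝 (dist (X₁ (T (N j))) (X₂ (T (N j))))) :=
      (((continuous_eval_const _).tendsto X₁).comp hX₁).dist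
        (((continuous_eval_const _).tendsto X₂).comp hX₂)
    refine ge_of_tendsto' hc fun k => ?_
    by_contra hlt
    have hmem : q ∈ closeEvent (T (M (φ (ψ k)))) (T (N j)) (δ j) y (z (φ (ψ k))) := not_le.mp hlt
    have := (hφP (ψ k)).1
    simp [Set.indicator_of_mem hmem] at this

end Separation

/-! ### A mixture with nondegenerate conditional laws -/

/-- The mixture of a sequence of laws with geometric weights. -/
def mixture {Ω : Type*} [MeasurableSpace Ω] (𝕏s : ℕ → ProbabilityMeasure Ω) :
    ProbabilityMeasure Ω :=
  ⟨Measure.sum fun n => (2⁻¹ : ℝ≥0∞) ^ (n + 1) • (𝕏s n : Measure Ω), ⟨by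
    rw [Measure.sum_apply _ MeasurableSet.univ]
    simp [ENNReal.tsum_geometric_add_one, ENNReal.one_sub_inv_two,
      ENNReal.inv_mul_cancel]⟩⟩

theorem coe_mixture {Ω : Type*} [MeasurableSpace Ω] (𝕏s : ℕ → ProbabilityMeasure Ω) :
    (mixture 𝕏s : Measure Ω) =
      Measure.sum fun n => (2⁻¹ : ℝ≥0∞) ^ (n + 1) • (𝕏s n : Measure Ω) := rfl

theorem tsum_weights : ∑' n : ℕ, (2⁻¹ : ℝ≥0∞) ^ (n + 1) = 1 := by
  simp [ENNReal.tsum_geometric_add_one, ENNReal.one_sub_inv_two, ENNReal.inv_mul_cancel]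

theorem absolutelyContinuous_mixture {Ω : Type*} [MeasurableSpace Ω]
    (𝕏s : ℕ → ProbabilityMeasure Ω) (n : ℕ) :
    (𝕏s n : Measure Ω) ≪ (mixture 𝕏s : Measure Ω) := by
  rw [coe_mixture]
  exact Measure.absolutelyContinuous_sum_right n
    (Measure.absolutelyContinuous_smul (pow_ne_zero _ (by simp)))

/-- Every condition is linear in the law once the noise marginal is fixed; in nonanticipation the
kernel depends on `𝕎` only. -/
theorem isTestedSolution_mixture {u : VelocityField d} {y : Space d}
    {𝕎 : ProbabilityMeasure (PathSpace d)}
    {𝕏s : ℕ → ProbabilityMeasure (PathSpace d × PathSpace d)}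
    (h : ∀ n, IsTestedSolution u y 𝕎 (𝕏s n)) : IsTestedSolution u y 𝕎 (mixture 𝕏s) where
  marginal := by
    ext s hs
    rw [Measure.map_apply measurable_snd hs, coe_mixture,
      Measure.sum_apply _ (measurable_snd hs)]
    have : ∀ n, ((2⁻¹ : ℝ≥0∞) ^ (n + 1) • (𝕏s n : Measure (PathSpace d × PathSpace d)))
        (Prod.snd ⁻¹' s) = (2⁻¹ : ℝ≥0∞) ^ (n + 1) * (𝕎 : Measure (PathSpace d)) s := fun n => by
      rw [Measure.smul_apply, ← Measure.map_apply measurable_snd hs, (h n).marginal, smul_eq_mul]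
    simp_rw [this]
    rw [ENNReal.tsum_mul_right, tsum_weights, one_mul]
  nonanticipating := by
    intro t f g
    have hr := measurable_restr (d := d) t
    have hk : Measurable fun w : PathSpaceUpTo d t => ∫ W, g W ∂(noiseKernel 𝕎 t w) :=
      (StronglyMeasurable.integral_kernel_prod_right' (κ := noiseKernel 𝕎 t)
        (f := fun z : PathSpaceUpTo d t × PathSpace d => g z.2)
        (g.continuous.comp continuous_snd).stronglyMeasurable).measurable
    have hf : Measurable fun p : PathSpace d × PathSpace d => f (restr t p.2, restr t p.1) :=
      f.continuous.measurable.comp ((hr.comp measurable_snd).prodMk (hr.comp measurable_fst))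
    have hi1 : Integrable (fun p : PathSpace d × PathSpace d =>
        f (restr t p.2, restr t p.1) * g p.2)
        (mixture 𝕏s : Measure (PathSpace d × PathSpace d)) := by
      refine Integrable.of_bound (C := ‖f‖ * ‖g‖)
        (hf.mul (g.continuous.measurable.comp measurable_snd)).aestronglyMeasurable
        (ae_of_all _ fun p => ?_)
      rw [norm_mul]
      gcongr
      · exact f.norm_coe_le_norm _
      · exact g.norm_coe_le_norm _
    have hi2 : Integrable (fun p : PathSpace d × PathSpace d =>
        f (restr t p.2, restr t p.1) * ∫ W, g W ∂(noiseKernel 𝕎 t (restr t p.2)))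
        (mixture 𝕏s : Measure (PathSpace d × PathSpace d)) := by
      refine Integrable.of_bound (C := ‖f‖ * ‖g‖)
        (hf.mul (hk.comp (hr.comp measurable_snd))).aestronglyMeasurable
        (ae_of_all _ fun p => ?_)
      rw [norm_mul]
      gcongr
      · exact f.norm_coe_le_norm _
      · exact g.norm_integral_le_norm _
    rw [coe_mixture] at hi1 hi2 ⊢
    rw [integral_sum_measure hi1, integral_sum_measure hi2]
    refine tsum_congr fun n => ?_
    rw [integral_smul_measure, integral_smul_measure, (h n).nonanticipating t f g]
  solves := by
    rw [coe_mixture, Measure.ae_sum_iff]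
    exact fun n => Measure.ae_smul_measure (h n).solves _

theorem ae_notMem_of_condDistrib_eq_zero {E A : Type*} [MeasurableSpace E] [StandardBorelSpace E]
    [Nonempty E] [MeasurableSpace A] (μ : Measure (E × A)) [IsFiniteMeasure μ] {B : Set E}
    (hB : MeasurableSet B) :
    ∀ᵐ p ∂μ, condDistrib Prod.fst Prod.snd μ p.2 B = 0 → p.1 ∉ B := by
  have h : μ.map Prod.snd ⊗ₘ condDistrib Prod.fst Prod.snd μ = μ.map fun p => (p.2, p.1) :=
    compProd_map_condDistrib measurable_fst.aemeasurable
  have hm : MeasurableSet {q : A × E | condDistrib Prod.fst Prod.snd μ q.1 B = 0 → q.2 ∉ B} := by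
    have : {q : A × E | condDistrib Prod.fst Prod.snd μ q.1 B = 0 → q.2 ∉ B} =
        ({q : A × E | condDistrib Prod.fst Prod.snd μ q.1 B = 0} ∩ {q | q.2 ∈ B})ᶜ := by
      ext q; simp
    rw [this]
    refine MeasurableSet.compl (MeasurableSet.inter ?_ (measurable_snd hB))
    exact ((Kernel.measurable_coe _ hB).comp measurable_fst) (measurableSet_singleton 0)
  have h2 : ∀ᵐ q ∂(μ.map Prod.snd ⊗ₘ condDistrib Prod.fst Prod.snd μ),
      condDistrib Prod.fst Prod.snd μ q.1 B = 0 → q.2 ∉ B := by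
    rw [Measure.ae_compProd_iff hm]
    refine ae_of_all _ fun a => ?_
    by_cases ha : condDistrib Prod.fst Prod.snd μ a B = 0
    · filter_upwards [measure_eq_zero_iff_ae_notMem.mp ha] with b hb _ using hb
    · exact ae_of_all _ fun b h => absurd h ha
  rw [h] at h2
  exact ae_of_ae_map (measurable_snd.prodMk measurable_fst).aemeasurable h2

/-- A real-valued code of the restriction of a path to `[0,ε]`. -/
def code (ε : I) (X : PathSpace d) : ℝ := embeddingReal (PathSpaceUpTo d ε) (restr ε X)

theorem measurable_code (ε : I) : Measurable (code (d := d) ε) :=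
  (measurableEmbedding_embeddingReal _).measurable.comp (measurable_restr ε)

theorem code_eq_iff {ε : I} {X Y : PathSpace d} : code ε X = code ε Y ↔ restr ε X = restr ε Y :=
  (measurableEmbedding_embeddingReal _).injective.eq_iff

theorem zero_or_compl_zero_of_support {G : Type*} [TopologicalSpace G] [HereditarilyLindelofSpace G]
    [MeasurableSpace G] (ν : Measure G) (hν : ν.support.Subsingleton) (B : Set G) :
    ν B = 0 ∨ ν Bᶜ = 0 := by
  have h := ν.measure_compl_support
  by_cases hB : ∃ x ∈ ν.support, x ∈ B
  · obtain ⟨x, hx, hxB⟩ := hB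
    exact Or.inr (measure_mono_null (fun z hz hzs => hz ((hν hx hzs : x = z) ▸ hxB)) h)
  · exact Or.inl (measure_mono_null (fun z hz hzs => hB ⟨z, hzs, hz⟩) h)

theorem coincidence_mono {ε ε' : I} (h : ε' ≤ ε) : coincidence d ε ⊆ coincidence d ε' := by
  intro p hp
  ext1 r
  exact DFunLike.congr_fun (show restr ε p.1 = restr ε p.2.1 from hp)
    (⟨r, le_trans r.2 h⟩ : Set.Iic ε)

/-- A weak solution none of whose conditional laws given the noise is a point mass. -/
theorem exists_solution_support_nontrivial {u : VelocityField d} {y : Space d}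
    {𝕎 : ProbabilityMeasure (PathSpace d)}
    (H : ∀ ε : I, 0 < ε → ∀ γ : ℝ≥0∞, 0 < γ →
      ∃ 𝕐 : ProbabilityMeasure (PathSpace d × PathSpace d × PathSpace d),
        IsTestedSolution u y 𝕎 (𝕐.map (f := fun p => (p.1, p.2.2)) (by fun_prop)) ∧
        IsTestedSolution u y 𝕎 (𝕐.map (f := fun p => (p.2.1, p.2.2)) (by fun_prop)) ∧
        (𝕐 : Measure (PathSpace d × PathSpace d × PathSpace d)) (coincidence d ε) ≤ γ) :
    ∃ 𝕏 : ProbabilityMeasure (PathSpace d × PathSpace d), IsTestedSolution u y 𝕎 𝕏 ∧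
      ∀ ε : I, 0 < ε → ∀ᵐ W ∂(𝕎 : Measure (PathSpace d)),
        (condLawUpTo 𝕏 ε W).support.Nontrivial := by
  let η : ℕ → I := fun i => ⟨1 / ((i : ℝ) + 1), by positivity,
    div_le_one_of_le₀ (by linarith [Nat.cast_nonneg (α := ℝ) i]) (by positivity)⟩
  have hη : ∀ i, 0 < η i := fun i => by
    change (0 : ℝ) < 1 / ((i : ℝ) + 1)
    positivity
  choose 𝕐 h𝕐1 h𝕐2 h𝕐 using fun i : ℕ => H (η i) (hη i) ((2⁻¹ : ℝ≥0∞) ^ i)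
    (ENNReal.pow_pos (by simp) i)
  -- Even indices list the first marginals and odd ones the second, so both marginals of each
  -- coupling are absolutely continuous with respect to the mixture.
  let 𝕏s : ℕ → ProbabilityMeasure (PathSpace d × PathSpace d) := fun n =>
    if Even n then (𝕐 (n / 2)).map (f := fun p => (p.1, p.2.2)) (by fun_prop)
    else (𝕐 (n / 2)).map (f := fun p => (p.2.1, p.2.2)) (by fun_prop)
  have h𝕏s : ∀ n, IsTestedSolution u y 𝕎 (𝕏s n) := fun n => by
    by_cases hn : Even n
    · simp only [𝕏s, if_pos hn]; exact h𝕐1 _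
    · simp only [𝕏s, if_neg hn]; exact h𝕐2 _
  have h𝕏0 : ∀ i, 𝕏s (2 * i) = (𝕐 i).map (f := fun p => (p.1, p.2.2)) (by fun_prop) := fun i => by
    simp [𝕏s]
  have h𝕏1 : ∀ i, 𝕏s (2 * i + 1) =
      (𝕐 i).map (f := fun p => (p.2.1, p.2.2)) (by fun_prop) := fun i => by
    have h2 : (2 * i + 1) / 2 = i := by omega
    simp only [𝕏s, if_neg (Nat.not_even_two_mul_add_one i), h2]
  let 𝕏 := mixture 𝕏s
  have h𝕏 : IsTestedSolution u y 𝕎 𝕏 := isTestedSolution_mixture h𝕏s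
  refine ⟨𝕏, h𝕏, fun ε hε => ?_⟩
  let κ : Kernel (PathSpace d) (PathSpace d) :=
    condDistrib Prod.fst Prod.snd (𝕏 : Measure (PathSpace d × PathSpace d))
  let B : ℚ → Set (PathSpace d) := fun q => code ε ⁻¹' Set.Iic (q : ℝ)
  have hB : ∀ q, MeasurableSet (B q) := fun q => measurable_code ε measurableSet_Iic
  -- Noise paths whose conditional law obeys a zero-one law on rational half-lines of the code. A
  -- support with at most one point implies this, and unlike the support condition it is visibly
  -- measurable.
  let D : Set (PathSpace d) := {W | ∀ q, κ W (B q) = 0 ∨ κ W (B q)ᶜ = 0}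
  have hD : MeasurableSet D := by
    have : D = ⋂ q, ({W | κ W (B q) = 0} ∪ {W | κ W (B q)ᶜ = 0}) := by
      ext W; simp only [D, Set.mem_iInter]; rfl
    rw [this]
    exact MeasurableSet.iInter fun q =>
      (Kernel.measurable_coe κ (hB q) (measurableSet_singleton 0)).union
        (Kernel.measurable_coe κ (hB q).compl (measurableSet_singleton 0))
  have hsub : ∀ W, W ∉ D → (condLawUpTo 𝕏 ε W).support.Nontrivial := by
    intro W hW
    by_contra hnt
    rw [Set.not_nontrivial_iff] at hnt
    refine hW fun q => ?_
    have hBG : MeasurableSet (embeddingReal (PathSpaceUpTo d ε) ⁻¹' Set.Iic (q : ℝ)) :=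
      (measurableEmbedding_embeddingReal _).measurable measurableSet_Iic
    have := zero_or_compl_zero_of_support _ hnt
      (embeddingReal (PathSpaceUpTo d ε) ⁻¹' Set.Iic (q : ℝ))
    rwa [condLawUpTo, Measure.map_apply (measurable_restr ε) hBG,
      Measure.map_apply (measurable_restr ε) hBG.compl] at this
  suffices h0 : (𝕎 : Measure (PathSpace d)) D = 0 by
    filter_upwards [measure_eq_zero_iff_ae_notMem.mp h0] with W hW using hsub W hW
  have hae : ∀ᵐ p ∂(𝕏 : Measure (PathSpace d × PathSpace d)), ∀ q,
      (κ p.2 (B q) = 0 → p.1 ∉ B q) ∧ (κ p.2 (B q)ᶜ = 0 → p.1 ∉ (B q)ᶜ) :=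
    ae_all_iff.mpr fun q => (ae_notMem_of_condDistrib_eq_zero _ (hB q)).and
      (ae_notMem_of_condDistrib_eq_zero _ (hB q).compl)
  -- On `D` the conditional law decides on which side of each rational the code lies. Both
  -- components of the coupling obey the same decision, so their codes agree.
  have hle : ∀ i, η i ≤ ε → (𝕎 : Measure (PathSpace d)) D ≤ (2⁻¹ : ℝ≥0∞) ^ i := by
    intro i hi
    refine le_trans ?_ ((measure_mono (coincidence_mono hi)).trans (h𝕐 i))
    have ha1 := (absolutelyContinuous_mixture 𝕏s (2 * i)).ae_le hae
    have ha2 := (absolutelyContinuous_mixture 𝕏s (2 * i + 1)).ae_le hae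
    rw [h𝕏0] at ha1
    rw [h𝕏1] at ha2
    have hb1 := ae_of_ae_map (f := fun p : PathSpace d × PathSpace d × PathSpace d =>
      (p.1, p.2.2)) (by fun_prop) ha1
    have hb2 := ae_of_ae_map (f := fun p : PathSpace d × PathSpace d × PathSpace d =>
      (p.2.1, p.2.2)) (by fun_prop) ha2
    have hmarg : (𝕎 : Measure (PathSpace d)) D =
        (𝕐 i : Measure (PathSpace d × PathSpace d × PathSpace d)) {p | p.2.2 ∈ D} := by
      rw [← (h𝕐1 i).marginal, Measure.map_apply measurable_snd hD]
      exact Measure.map_apply (f := fun p : PathSpace d × PathSpace d × PathSpace d =>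
        (p.1, p.2.2)) (by fun_prop) (measurable_snd hD)
    rw [hmarg]
    refine measure_mono_ae ?_
    filter_upwards [hb1, hb2] with p hp1 hp2 hpD
    have hpD' : p.2.2 ∈ D := hpD
    change restr ε p.1 = restr ε p.2.1
    rw [← code_eq_iff]
    have hiff : ∀ q : ℚ, p.1 ∈ B q ↔ p.2.1 ∈ B q := by
      intro q
      rcases hpD' q with h | h
      · exact iff_of_false ((hp1 q).1 h) ((hp2 q).1 h)
      · exact iff_of_true (not_not.mp ((hp1 q).2 h)) (not_not.mp ((hp2 q).2 h))
    by_contra hne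
    rcases lt_or_gt_of_ne hne with h | h <;> obtain ⟨q, hq1, hq2⟩ := exists_rat_btwn h
    · exact absurd ((hiff q).mp hq1.le) (not_le.mpr hq2)
    · exact absurd ((hiff q).mpr hq1.le) (not_le.mpr hq2)
  have hev : ∀ᶠ i in atTop, (𝕎 : Measure (PathSpace d)) D ≤ (2⁻¹ : ℝ≥0∞) ^ i := by
    have := (tendsto_one_div_add_atTop_nhds_zero_nat (𝕜 := ℝ)).eventually_le_const
      (show (0 : ℝ) < ε from hε)
    filter_upwards [this] with i hi using hle i hi
  exact le_antisymm (ge_of_tendsto (ENNReal.tendsto_pow_atTop_nhds_zero_of_lt_one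
    ENNReal.one_half_lt_one) (by simpa using hev)) zero_le

/-! ### Quantiles and the half shift -/

/-- The uniform distribution on `(0,1)`. -/
def uniformLaw : Measure ℝ := volume.restrict (Set.Ioo 0 1)

instance instIsProbabilityMeasureUniformLaw : IsProbabilityMeasure uniformLaw :=
  ⟨by simp [uniformLaw]⟩

open Classical in
/-- The quantile function of a probability measure on the line. -/
def quantile (ν : Measure ℝ) (r : ℝ) : ℝ :=
  if r ∈ Set.Ioo (0 : ℝ) 1 then sInf {x | r ≤ cdf ν x} else 0

/-- The Galois connection between quantile and distribution function: right continuity makes the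
infimum attained. -/
theorem quantile_le_iff (ν : Measure ℝ) {r : ℝ} (hr : r ∈ Set.Ioo (0 : ℝ) 1) (x : ℝ) :
    quantile ν r ≤ x ↔ r ≤ cdf ν x := by
  rw [quantile, if_pos hr]
  have hne : {x | r ≤ cdf ν x}.Nonempty :=
    ((tendsto_cdf_atTop ν).eventually_const_le hr.2).exists
  have hbdd : BddBelow {x | r ≤ cdf ν x} := by
    obtain ⟨b, hb⟩ := ((tendsto_cdf_atBot ν).eventually_lt_const hr.1).exists
    exact ⟨b, fun x hx => le_of_lt ((monotone_cdf ν).reflect_lt (hb.trans_le hx))⟩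
  refine ⟨fun h => ?_, fun h => csInf_le hbdd h⟩
  refine le_trans ?_ (monotone_cdf ν h)
  have hc : Tendsto (cdf ν) (𝓝[>] (sInf {x | r ≤ cdf ν x}))
      (𝓝 (cdf ν (sInf {x | r ≤ cdf ν x}))) :=
    ((cdf ν).right_continuous _).mono Set.Ioi_subset_Ici_self
  refine ge_of_tendsto hc ?_
  filter_upwards [self_mem_nhdsWithin] with z hz
  obtain ⟨w, hw, hwz⟩ := exists_lt_of_csInf_lt hne hz
  exact hw.trans (monotone_cdf ν hwz.le)

theorem quantile_mono (ν : Measure ℝ) {r s : ℝ} (hr : r ∈ Set.Ioo (0 : ℝ) 1)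
    (hs : s ∈ Set.Ioo (0 : ℝ) 1) (h : r ≤ s) : quantile ν r ≤ quantile ν s :=
  (quantile_le_iff ν hr _).mpr (h.trans ((quantile_le_iff ν hs _).mp le_rfl))

theorem measurable_quantile_kernel {A : Type*} [MeasurableSpace A] (κ : Kernel A ℝ)
    [IsMarkovKernel κ] : Measurable fun p : A × ℝ => quantile (κ p.1) p.2 := by
  refine measurable_of_Iic fun x => ?_
  have : (fun p : A × ℝ => quantile (κ p.1) p.2) ⁻¹' Set.Iic x =
      ({p | p.2 ∈ Set.Ioo (0 : ℝ) 1} ∩ {p | p.2 ≤ (κ p.1 (Set.Iic x)).toReal}) ∪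
      ({p | p.2 ∈ Set.Ioo (0 : ℝ) 1}ᶜ ∩ {_p | (0 : ℝ) ≤ x}) := by
    ext p
    by_cases hp : p.2 ∈ Set.Ioo (0 : ℝ) 1
    · have h := quantile_le_iff (κ p.1) hp x
      rw [cdf_eq_real, measureReal_def] at h
      simp only [Set.mem_preimage, Set.mem_Iic, h, Set.mem_union, Set.mem_inter_iff,
        Set.mem_compl_iff, Set.mem_ofPred_eq, hp, true_and, not_true_eq_false, false_and, or_false]
    · simp only [Set.mem_preimage, Set.mem_Iic, quantile, Set.mem_union, Set.mem_inter_iff,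
        Set.mem_compl_iff, Set.mem_ofPred_eq, hp, false_and, not_false_eq_true, true_and, false_or,
        if_false]
  rw [this]
  have hI : MeasurableSet {p : A × ℝ | p.2 ∈ Set.Ioo (0 : ℝ) 1} := measurable_snd measurableSet_Ioo
  refine (hI.inter (measurableSet_le measurable_snd ?_)).union (hI.compl.inter (.const _))
  exact ((Kernel.measurable_coe κ measurableSet_Iic).comp measurable_fst).ennreal_toReal

theorem measurable_quantile (ν : Measure ℝ) [IsProbabilityMeasure ν] : Measurable (quantile ν) :=
  (measurable_quantile_kernel (Kernel.const Unit ν)).comp (measurable_prodMk_left (x := ()))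

theorem map_quantile (ν : Measure ℝ) [IsProbabilityMeasure ν] :
    uniformLaw.map (quantile ν) = ν := by
  have : IsProbabilityMeasure (uniformLaw.map (quantile ν)) :=
    Measure.isProbabilityMeasure_map (measurable_quantile ν).aemeasurable
  refine Measure.ext_of_Iic _ _ fun x => ?_
  rw [Measure.map_apply (measurable_quantile ν) measurableSet_Iic, uniformLaw,
    Measure.restrict_apply (measurable_quantile ν measurableSet_Iic)]
  have h1 : quantile ν ⁻¹' Set.Iic x ∩ Set.Ioo 0 1 = Set.Iic (cdf ν x) ∩ Set.Ioo 0 1 := by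
    ext r
    simp only [Set.mem_inter_iff, Set.mem_preimage, Set.mem_Iic, and_congr_left_iff]
    exact fun hr => quantile_le_iff ν hr x
  rw [h1, ← Measure.restrict_apply measurableSet_Iic, Measure.restrict_congr_set Ioo_ae_eq_Ioc,
    Measure.restrict_apply measurableSet_Iic, Set.inter_comm, Set.Ioc_inter_Iic,
    min_eq_right (cdf_le_one ν x), Real.volume_Ioc, sub_zero, ofReal_cdf]

/-- If the median atom has mass at most `1/2`, then at most one quantile level is shared with the
level shifted by `1/2`. -/
theorem eq_leftLim_of_quantile_eq (ν : Measure ℝ) [IsProbabilityMeasure ν]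
    (hν : ν {quantile ν (1 / 2)} ≤ 1 / 2) {r : ℝ} (hr0 : 0 < r) (hr1 : r < 1 / 2)
    (h : quantile ν r = quantile ν (r + 1 / 2)) :
    r = Function.leftLim (cdf ν) (quantile ν (1 / 2)) := by
  set m := quantile ν (1 / 2)
  have hr : r ∈ Set.Ioo (0 : ℝ) 1 := ⟨hr0, by linarith⟩
  have hr' : r + 1 / 2 ∈ Set.Ioo (0 : ℝ) 1 := ⟨by linarith, by linarith⟩
  have hh : (1 / 2 : ℝ) ∈ Set.Ioo (0 : ℝ) 1 := ⟨by norm_num, by norm_num⟩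
  -- The median level lies between `r` and `r + 1/2`, so equal quantiles must equal the median `m`.
  -- Then both levels lie in the jump of the distribution function at `m`, which has length at most
  -- `1/2`, so `r` is its lower end.
  have hm1 : quantile ν r = m := le_antisymm (quantile_mono ν hr hh hr1.le)
    (h ▸ quantile_mono ν hh hr' (by linarith))
  have hm2 : r + 1 / 2 ≤ cdf ν m := (quantile_le_iff ν hr' m).mp (by rw [← h, hm1])
  have hm3 : Function.leftLim (cdf ν) m ≤ r := by
    refine le_of_tendsto ((monotone_cdf ν).tendsto_leftLim m) ?_
    filter_upwards [self_mem_nhdsWithin] with x hx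
    by_contra hlt
    have := (quantile_le_iff ν hr x).mpr (not_le.mp hlt).le
    rw [hm1] at this
    exact absurd hx (not_lt.mpr this)
  have hm4 : cdf ν m - Function.leftLim (cdf ν) m ≤ 1 / 2 := by
    have h1 := (cdf ν).measure_singleton m
    rw [measure_cdf] at h1
    rw [h1] at hν
    have h2 : (1 / 2 : ℝ≥0∞) = ENNReal.ofReal (1 / 2) := by
      rw [ENNReal.ofReal_div_of_pos two_pos]; simp
    rw [h2] at hν
    exact (ENNReal.ofReal_le_ofReal_iff (by norm_num)).mp hν
  linarith

/-- The rotation of `(0,1)` by `1/2`. -/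
def halfShift (r : ℝ) : ℝ := if r < 1 / 2 then r + 1 / 2 else r - 1 / 2

theorem measurable_halfShift : Measurable halfShift :=
  Measurable.ite measurableSet_Iio (by fun_prop) (by fun_prop)

theorem map_halfShift : uniformLaw.map halfShift = uniformLaw := by
  have hsplit : uniformLaw = volume.restrict (Set.Ico (0 : ℝ) (1 / 2)) +
      volume.restrict (Set.Ico (1 / 2 : ℝ) 1) := by
    rw [uniformLaw, Measure.restrict_congr_set Ioo_ae_eq_Ico,
      ← Set.Ico_union_Ico_eq_Ico (b := (1 / 2 : ℝ)) (by norm_num) (by norm_num),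
      Measure.restrict_union (Set.Ico_disjoint_Ico_same) measurableSet_Ico]
  have h1 : (volume.restrict (Set.Ico (0 : ℝ) (1 / 2))).map halfShift =
      volume.restrict (Set.Ico (1 / 2 : ℝ) 1) := by
    have hp := ((measurePreserving_add_right (volume : Measure ℝ) (1 / 2)).restrict_preimage
      (measurableSet_Ico (a := (1 / 2 : ℝ)) (b := 1))).map_eq
    rw [Set.preimage_add_const_Ico] at hp
    norm_num at hp ⊢
    rw [← hp]
    refine Measure.map_congr ?_
    filter_upwards [ae_restrict_mem measurableSet_Ico] with r hr
    rw [halfShift, if_pos (by linarith [hr.2])]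
  have h2 : (volume.restrict (Set.Ico (1 / 2 : ℝ) 1)).map halfShift =
      volume.restrict (Set.Ico (0 : ℝ) (1 / 2)) := by
    have hp := ((measurePreserving_sub_right (volume : Measure ℝ) (1 / 2)).restrict_preimage
      (measurableSet_Ico (a := (0 : ℝ)) (b := 1 / 2))).map_eq
    rw [Set.preimage_sub_const_Ico] at hp
    norm_num at hp ⊢
    rw [← hp]
    refine Measure.map_congr ?_
    filter_upwards [ae_restrict_mem measurableSet_Ico] with r hr
    rw [halfShift, if_neg (by linarith [hr.1])]
  rw [hsplit, Measure.map_add _ _ measurable_halfShift, h1, h2, add_comm]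

theorem ae_quantile_ne (ν : Measure ℝ) [IsProbabilityMeasure ν]
    (hν : ν {quantile ν (1 / 2)} ≤ 1 / 2) :
    ∀ᵐ r ∂uniformLaw, quantile ν r ≠ quantile ν (halfShift r) := by
  set a := Function.leftLim (cdf ν) (quantile ν (1 / 2))
  -- Bad levels: `a` from the lower half, `a + 1/2` from the upper half, and `1/2` itself, whose
  -- shift `0` lies outside the open interval.
  have hfin : ∀ᵐ r : ℝ, r ∉ ({a, a + 1 / 2, 1 / 2} : Set ℝ) :=
    measure_eq_zero_iff_ae_notMem.mp (Set.Finite.measure_zero (Set.toFinite _) _)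
  rw [uniformLaw]
  filter_upwards [ae_restrict_of_ae hfin, ae_restrict_mem measurableSet_Ioo] with r hr hr01 heq
  simp only [Set.mem_insert_iff, Set.mem_singleton_iff, not_or] at hr
  rcases lt_or_ge r (1 / 2) with h | h
  · rw [halfShift, if_pos h] at heq
    exact hr.1 (eq_leftLim_of_quantile_eq ν hν hr01.1 h heq)
  · rw [halfShift, if_neg (not_lt.mpr h)] at heq
    have h' : 1 / 2 < r := lt_of_le_of_ne h (Ne.symm hr.2.2)
    have := eq_leftLim_of_quantile_eq ν hν (r := r - 1 / 2) (by linarith) (by linarith [hr01.2])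
      (by rw [sub_add_cancel]; exact heq.symm)
    exact hr.2.1 (by linarith)

/-! ### Self-couplings with small or zero coincidence -/

section Coupling

variable {E A : Type*} [MeasurableSpace E] [MeasurableSpace A]

/-- If a law can be coupled with itself, over its second component, with arbitrarily small
coincidence probability, then almost all conditional laws have no atom of mass above `1/2`. -/
theorem ae_median_atom_le_half (μ : Measure (E × A)) [IsProbabilityMeasure μ] {e : E → ℝ}
    (he : Measurable e)
    (H : ∀ γ : ℝ≥0∞, 0 < γ → ∃ π : Measure (E × E × A), π.map (fun p => (p.1, p.2.2)) = μ ∧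
      π.map (fun p => (p.2.1, p.2.2)) = μ ∧ π {p | e p.1 = e p.2.1} ≤ γ) :
    ∀ᵐ a ∂(μ.map Prod.snd), condDistrib (fun p => e p.1) Prod.snd μ a
      {quantile (condDistrib (fun p => e p.1) Prod.snd μ a) (1 / 2)} ≤ 1 / 2 := by
  set κ := condDistrib (fun p : E × A => e p.1) Prod.snd μ with hκ
  -- An atom of mass above `1/2` can only sit at the median, which selects it measurably.
  let m : A → ℝ := fun a => quantile (κ a) (1 / 2)
  have hm : Measurable m := (measurable_quantile_kernel κ).comp measurable_prodMk_right
  have hgraph : MeasurableSet {q : A × ℝ | q.2 = m q.1} :=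
    measurableSet_eq_fun measurable_snd (hm.comp measurable_fst)
  have hatom : Measurable fun a => κ a {m a} := Kernel.measurable_kernel_prodMk_left hgraph
  let D : Set A := {a | 1 / 2 < κ a {m a}}
  have hD : MeasurableSet D := measurableSet_lt measurable_const hatom
  have hprob : IsProbabilityMeasure (μ.map Prod.snd) :=
    Measure.isProbabilityMeasure_map measurable_snd.aemeasurable
  suffices h0 : μ.map Prod.snd D = 0 by
    filter_upwards [measure_eq_zero_iff_ae_notMem.mp h0] with a ha using not_lt.mp ha
  have he1 : Measurable fun p : E × A => e p.1 := he.comp measurable_fst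
  let S : Set (E × A) := {p | p.2 ∈ D ∧ e p.1 = m p.2}
  have hS : MeasurableSet S :=
    (measurable_snd hD).inter (measurableSet_eq_fun he1 (hm.comp measurable_snd))
  have hDg : MeasurableSet ({q : A × ℝ | q.1 ∈ D} ∩ {q | q.2 = m q.1}) :=
    (measurable_fst hD).inter hgraph
  have hSmass : μ S = ∫⁻ a in D, κ a {m a} ∂(μ.map Prod.snd) := by
    have h1 : μ S = (μ.map fun p => (p.2, e p.1)) ({q | q.1 ∈ D} ∩ {q | q.2 = m q.1}) := by
      rw [Measure.map_apply (measurable_snd.prodMk he1) hDg]; rfl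
    rw [h1, ← compProd_map_condDistrib he1.aemeasurable, ← hκ,
      Measure.compProd_apply hDg, ← lintegral_indicator hD]
    refine lintegral_congr fun a => ?_
    by_cases ha : a ∈ D
    · rw [Set.indicator_of_mem ha]
      congr 1
      ext r
      simp [ha]
    · rw [Set.indicator_of_notMem ha]
      have : Prod.mk a ⁻¹' ({q : A × ℝ | q.1 ∈ D} ∩ {q | q.2 = m q.1}) = ∅ := by
        ext r; simp [ha]
      rw [this, measure_empty]
  -- Inclusion-exclusion: if both copies are at the atom, they coincide, which has probability at
  -- most `γ`. Each copy lies in `S` with mass `μ S`, and the union lies over `D`. Mass above `1/2`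
  -- on a nonnull `D` would violate this bound.
  have hle : μ S + μ S ≤ μ.map Prod.snd D := by
    refine ENNReal.le_of_forall_pos_le_add fun γ hγ _ => ?_
    obtain ⟨π, h1, h2, h3⟩ := H γ (by exact_mod_cast hγ)
    have hf1 : Measurable fun p : E × E × A => (p.1, p.2.2) := by fun_prop
    have hf2 : Measurable fun p : E × E × A => (p.2.1, p.2.2) := by fun_prop
    have e1 : μ S = π ((fun p : E × E × A => (p.1, p.2.2)) ⁻¹' S) := by
      rw [← Measure.map_apply hf1 hS, h1]
    have e2 : μ S = π ((fun p : E × E × A => (p.2.1, p.2.2)) ⁻¹' S) := by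
      rw [← Measure.map_apply hf2 hS, h2]
    have e3 : μ.map Prod.snd D = π {p | p.2.2 ∈ D} := by
      rw [← h1, Measure.map_map measurable_snd hf1, Measure.map_apply (measurable_snd.comp hf1) hD]
      rfl
    nth_rw 1 [e1]
    rw [e2, e3, ← measure_union_add_inter _ (hf2 hS)]
    refine add_le_add (measure_mono ?_) (le_trans (measure_mono ?_) h3)
    · rintro p (hp | hp)
      · exact hp.1
      · exact hp.1
    · rintro p ⟨hp1, hp2⟩
      exact hp1.2.trans hp2.2.symm
  by_contra hne
  have hlt : ∫⁻ _a in D, (1 / 2 : ℝ≥0∞) ∂(μ.map Prod.snd) <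
      ∫⁻ a in D, κ a {m a} ∂(μ.map Prod.snd) := by
    refine setLIntegral_strict_mono hD hne hatom ?_ (ae_of_all _ fun a ha => ha)
    simp only [lintegral_const, Measure.restrict_apply MeasurableSet.univ, Set.univ_inter]
    exact ENNReal.mul_ne_top (by simp) (measure_ne_top _ _)
  rw [setLIntegral_const, ← hSmass] at hlt
  have : μ.map Prod.snd D < μ S + μ S := by
    calc μ.map Prod.snd D = 1 / 2 * μ.map Prod.snd D + 1 / 2 * μ.map Prod.snd D := by
          rw [← add_mul, ENNReal.add_halves, one_mul]
      _ < _ := ENNReal.add_lt_add hlt hlt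
  exact absurd hle (not_le.mpr this)

/-- A law without conditional atoms of mass above `1/2` can be coupled with itself, over its second
component, in such a way that the two copies are almost surely distinct. -/
theorem exists_disjoint_coupling [StandardBorelSpace E] [Nonempty E] (μ : Measure (E × A))
    [IsProbabilityMeasure μ] {e : E → ℝ}
    (he : Measurable e)
    (H : ∀ᵐ a ∂(μ.map Prod.snd), condDistrib (fun p => e p.1) Prod.snd μ a
      {quantile (condDistrib (fun p => e p.1) Prod.snd μ a) (1 / 2)} ≤ 1 / 2) :
    ∃ π : Measure (E × E × A), π.map (fun p => (p.1, p.2.2)) = μ ∧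
      π.map (fun p => (p.2.1, p.2.2)) = μ ∧ π {p | e p.1 = e p.2.1} = 0 := by
  set κ := condDistrib (fun p : E × A => e p.1) Prod.snd μ with hκ
  have he1 : Measurable fun p : E × A => e p.1 := he.comp measurable_fst
  have hprob : IsProbabilityMeasure (μ.map Prod.snd) :=
    Measure.isProbabilityMeasure_map measurable_snd.aemeasurable
  let β : Measure (A × ℝ) := (μ.map Prod.snd).prod uniformLaw
  -- The coupling is built at the level of codes; this kernel then lifts a code to an element of `E`
  -- with the correct conditional law.
  let ρ : Kernel (A × ℝ) E := condDistrib Prod.fst (fun p : E × A => (p.2, e p.1)) μ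
  have hp2 : Measurable fun p : E × A => (p.2, e p.1) := measurable_snd.prodMk he1
  have hρ : μ.map (fun p => (p.2, e p.1)) ⊗ₘ ρ = μ.map fun p => ((p.2, e p.1), p.1) :=
    compProd_map_condDistrib measurable_fst.aemeasurable
  let Q : A × ℝ → A × ℝ := fun b => (b.1, quantile (κ b.1) b.2)
  have hQ : Measurable Q := measurable_fst.prodMk (measurable_quantile_kernel κ)
  let τ : A × ℝ → A × ℝ := Prod.map id halfShift
  have hτ : Measurable τ := measurable_id.prodMap measurable_halfShift
  have hβQ : β.map Q = μ.map fun p => (p.2, e p.1) := by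
    rw [← compProd_map_condDistrib he1.aemeasurable, ← hκ]
    ext s hs
    rw [Measure.map_apply hQ hs, Measure.prod_apply (hQ hs), Measure.compProd_apply hs]
    refine lintegral_congr fun a => ?_
    conv_rhs => rw [← map_quantile (κ a)]
    rw [Measure.map_apply (measurable_quantile _) (measurable_prodMk_left hs)]
    rfl
  have hβτ : β.map (Q ∘ τ) = μ.map fun p => (p.2, e p.1) := by
    rw [← Measure.map_map hQ hτ, ← hβQ]
    congr 1
    change β.map (Prod.map id halfShift) = β
    rw [← Measure.map_prod_map _ _ measurable_id measurable_halfShift, Measure.map_id,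
      map_halfShift]
  have hmarg : ∀ R : A × ℝ → A × ℝ, Measurable R → (∀ b, (R b).1 = b.1) →
      β.map R = (μ.map fun p => (p.2, e p.1)) → ∀ s : Set (E × A), MeasurableSet s →
      ∫⁻ b, ρ (R b) {X | (X, b.1) ∈ s} ∂β = μ s := by
    intro R hR hR1 hRβ s hs
    have hs' : MeasurableSet {q : (A × ℝ) × E | (q.2, q.1.1) ∈ s} :=
      (measurable_snd.prodMk (measurable_fst.comp measurable_fst)) hs
    calc ∫⁻ b, ρ (R b) {X | (X, b.1) ∈ s} ∂β
        = ∫⁻ b, ρ (R b) (Prod.mk (R b) ⁻¹' {q : (A × ℝ) × E | (q.2, q.1.1) ∈ s}) ∂β := by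
          refine lintegral_congr fun b => ?_
          congr 1
          ext X
          simp [hR1 b]
      _ = ∫⁻ c, ρ c (Prod.mk c ⁻¹' {q : (A × ℝ) × E | (q.2, q.1.1) ∈ s}) ∂(β.map R) :=
          (lintegral_map (Kernel.measurable_kernel_prodMk_left hs') hR).symm
      _ = μ s := by
          rw [hRβ, ← Measure.compProd_apply hs', hρ,
            Measure.map_apply (hp2.prodMk measurable_fst) hs']
          rfl
  -- The lift almost surely has the prescribed code, so distinct codes yield distinct elements.
  have hcode : ∀ R : A × ℝ → A × ℝ, Measurable R →
      β.map R = (μ.map fun p => (p.2, e p.1)) → ∀ᵐ b ∂β, ∀ᵐ X ∂(ρ (R b)), e X = (R b).2 := by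
    intro R hR hRβ
    have hs : MeasurableSet {q : (A × ℝ) × E | e q.2 = q.1.2} :=
      measurableSet_eq_fun (he.comp measurable_snd) (measurable_snd.comp measurable_fst)
    have h1 : ∀ᵐ q ∂(μ.map fun p => ((p.2, e p.1), p.1)), e q.2 = q.1.2 :=
      (ae_map_iff (hp2.prodMk measurable_fst).aemeasurable hs).mpr (ae_of_all _ fun p => rfl)
    rw [← hρ, Measure.ae_compProd_iff hs, ← hRβ] at h1
    exact ae_of_ae_map hR.aemeasurable h1
  let ρ₁ : Kernel (A × ℝ) E := ρ.comap Q hQ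
  let ρ₂ : Kernel (A × ℝ) E := ρ.comap (Q ∘ τ) (hQ.comp hτ)
  let J : (A × ℝ) × E × E → E × E × A := fun z => (z.2.1, z.2.2, z.1.1)
  have hJ : Measurable J := by fun_prop
  refine ⟨(β ⊗ₘ (ρ₁ ×ₖ ρ₂)).map J, ?_, ?_, ?_⟩
  · ext s hs
    have hf : Measurable fun p : E × E × A => (p.1, p.2.2) := by fun_prop
    rw [Measure.map_map hf hJ, Measure.map_apply (hf.comp hJ) hs,
      Measure.compProd_apply ((hf.comp hJ) hs), ← hmarg Q hQ (fun b => rfl) hβQ s hs]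
    refine lintegral_congr fun b => ?_
    have hsb : MeasurableSet {X | (X, b.1) ∈ s} := measurable_prodMk_right hs
    rw [Kernel.prod_apply]
    have : Prod.mk b ⁻¹' ((fun p : E × E × A => (p.1, p.2.2)) ∘ J ⁻¹' s) =
        {X | (X, b.1) ∈ s} ×ˢ Set.univ := by
      ext X; simp [J]
    rw [this, Measure.prod_prod, measure_univ, mul_one]
    rfl
  · ext s hs
    have hf : Measurable fun p : E × E × A => (p.2.1, p.2.2) := by fun_prop
    rw [Measure.map_map hf hJ, Measure.map_apply (hf.comp hJ) hs,
      Measure.compProd_apply ((hf.comp hJ) hs),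
      ← hmarg (Q ∘ τ) (hQ.comp hτ) (fun b => rfl) hβτ s hs]
    refine lintegral_congr fun b => ?_
    rw [Kernel.prod_apply]
    have : Prod.mk b ⁻¹' ((fun p : E × E × A => (p.2.1, p.2.2)) ∘ J ⁻¹' s) =
        Set.univ ×ˢ {X | (X, b.1) ∈ s} := by
      ext X; simp [J]
    rw [this, Measure.prod_prod, measure_univ, one_mul]
    rfl
  · have hes : MeasurableSet {p : E × E × A | e p.1 = e p.2.1} :=
      measurableSet_eq_fun (he.comp measurable_fst)
        (he.comp (measurable_fst.comp measurable_snd))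
    have hne : ∀ᵐ b ∂β, (Q b).2 ≠ ((Q ∘ τ) b).2 := by
      have hms : MeasurableSet {b | (Q b).2 ≠ ((Q ∘ τ) b).2} :=
        (measurableSet_eq_fun (measurable_snd.comp hQ)
          (measurable_snd.comp (hQ.comp hτ))).compl
      rw [Measure.ae_prod_iff_ae_ae hms]
      filter_upwards [H] with a ha using ae_quantile_ne (κ a) ha
    rw [measure_eq_zero_iff_ae_notMem, ae_map_iff
      (p := fun x => x ∉ {p : E × E × A | e p.1 = e p.2.1}) hJ.aemeasurable hes.compl,
      Measure.ae_compProd_iff (p := fun x => J x ∉ {p : E × E × A | e p.1 = e p.2.1})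
        (hJ hes.compl)]
    filter_upwards [hne, hcode Q hQ hβQ, hcode (Q ∘ τ) (hQ.comp hτ) hβτ] with b hb h1 h2
    rw [Kernel.prod_apply]
    have h1' : ∀ᵐ X ∂((ρ₁ b).prod (ρ₂ b)), e X.1 = (Q b).2 :=
      Measure.quasiMeasurePreserving_fst.ae h1
    have h2' : ∀ᵐ X ∂((ρ₁ b).prod (ρ₂ b)), e X.2 = ((Q ∘ τ) b).2 :=
      Measure.quasiMeasurePreserving_snd.ae h2
    filter_upwards [h1', h2'] with X hX1 hX2 heq
    have heq' : e X.1 = e X.2 := heq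
    exact hb (by rw [← hX1, ← hX2, heq'])

end Coupling

/-! ### Consequences for weak solutions -/

theorem not_pathwiseUniqueness {u : VelocityField d} {y : Space d}
    {𝕎 : ProbabilityMeasure (PathSpace d)} {ε : I}
    (h : ∃ 𝕐 : ProbabilityMeasure (PathSpace d × PathSpace d × PathSpace d),
      IsWeakCoupling u y 𝕎 𝕐 ∧
      (𝕐 : Measure (PathSpace d × PathSpace d × PathSpace d)) (coincidence d ε) ≤ 1 / 2) :
    ¬ PathwiseUniqueness u y 𝕎 := by
  intro hu
  obtain ⟨𝕐, h1, h2⟩ := h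
  have h3 : ∀ᵐ p ∂(𝕐 : Measure (PathSpace d × PathSpace d × PathSpace d)),
      p ∈ coincidence d ε := by
    filter_upwards [hu 𝕐 h1] with p hp
    exact congrArg (restr ε) hp
  have h4 : (𝕐 : Measure (PathSpace d × PathSpace d × PathSpace d)) (coincidence d ε) = 1 := by
    exact (measure_congr (eventuallyEq_univ.mpr h3)).trans measure_univ
  rw [h4] at h2
  exact absurd h2 (not_le.mpr (by rw [one_div]; exact ENNReal.one_half_lt_one))

/-- Under weak uniqueness there is a coupling of two weak solutions which almost surely differ. -/
theorem exists_coupling_coincidence_eq_zero {u : VelocityField d} {y : Space d}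
    {𝕎 : ProbabilityMeasure (PathSpace d)}
    {𝕏 : ProbabilityMeasure (PathSpace d × PathSpace d)} (h𝕏 : IsWeakSolution u y 𝕎 𝕏)
    (huniq : WeakUniqueness u y 𝕎) (ε : I)
    (H : ∀ γ : ℝ≥0∞, 0 < γ →
      ∃ 𝕐 : ProbabilityMeasure (PathSpace d × PathSpace d × PathSpace d),
        IsWeakCoupling u y 𝕎 𝕐 ∧
        (𝕐 : Measure (PathSpace d × PathSpace d × PathSpace d)) (coincidence d ε) ≤ γ) :
    ∃ 𝕐 : ProbabilityMeasure (PathSpace d × PathSpace d × PathSpace d),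
      IsWeakCoupling u y 𝕎 𝕐 ∧
      (𝕐 : Measure (PathSpace d × PathSpace d × PathSpace d)) (coincidence d ε) = 0 := by
  have hco : {p : PathSpace d × PathSpace d × PathSpace d | code ε p.1 = code ε p.2.1} =
      coincidence d ε := by
    ext p; exact code_eq_iff
  -- Weak uniqueness identifies both marginals of every available coupling with `𝕏`, which makes it
  -- a self-coupling.
  obtain ⟨π, h1, h2, h3⟩ := exists_disjoint_coupling (𝕏 : Measure (PathSpace d × PathSpace d))
    (measurable_code ε) (ae_median_atom_le_half _ (measurable_code ε) fun γ hγ => by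
      obtain ⟨𝕐, h𝕐, hle⟩ := H γ hγ
      refine ⟨𝕐, congrArg Subtype.val (huniq _ 𝕏 h𝕐.1 h𝕏),
        congrArg Subtype.val (huniq _ 𝕏 h𝕐.2 h𝕏), ?_⟩
      rw [hco]; exact hle)
  have hf1 : Measurable fun p : PathSpace d × PathSpace d × PathSpace d => (p.1, p.2.2) := by
    fun_prop
  have hπ : IsProbabilityMeasure π := by
    refine ⟨?_⟩
    have : (π.map fun p => (p.1, p.2.2)) Set.univ = 1 := by rw [h1]; exact measure_univ
    rwa [Measure.map_apply hf1 MeasurableSet.univ, Set.preimage_univ] at this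
  refine ⟨⟨π, hπ⟩, ⟨?_, ?_⟩, ?_⟩
  · convert h𝕏 using 1
    exact Subtype.ext h1
  · convert h𝕏 using 1
    exact Subtype.ext h2
  · rw [← hco]; exact h3

end AdditiveSDE

end

theorem theorem2p4 (d : ℕ) (hd : 1 ≤ d)
    (𝕎 : ProbabilityMeasure (AdditiveSDE.PathSpace d))
    (h𝕎 : AdditiveSDE.IsRegularNoise 𝕎)
    (𝕌 : ProbabilityMeasure (AdditiveSDE.VelocityField d))
    (T : ℕ → I) (hTpos : ∀ n, 0 < T n) (hT : Tendsto T atTop (𝓝 0))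
    (hsep : ∀ᵐ W ∂(𝕎 : Measure (AdditiveSDE.PathSpace d)),
      AdditiveSDE.ExplosivelySeparating 𝕌 T W)
    (y : AdditiveSDE.Space d) :
    (∀ᵐ u ∂(𝕌 : Measure (AdditiveSDE.VelocityField d)),
      ¬ AdditiveSDE.PathwiseUniqueness u y 𝕎 ∧
      (∀ ε : I, 0 < ε → ∀ γ : ℝ≥0∞, 0 < γ →
        ∃ 𝕐 : ProbabilityMeasure
            (AdditiveSDE.PathSpace d × AdditiveSDE.PathSpace d × AdditiveSDE.PathSpace d),
          AdditiveSDE.IsWeakCoupling u y 𝕎 𝕐 ∧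
          (𝕐 : Measure (AdditiveSDE.PathSpace d × AdditiveSDE.PathSpace d ×
            AdditiveSDE.PathSpace d)) (AdditiveSDE.coincidence d ε) ≤ γ) ∧
      (∃ 𝕏 : ProbabilityMeasure (AdditiveSDE.PathSpace d × AdditiveSDE.PathSpace d),
        AdditiveSDE.IsWeakSolution u y 𝕎 𝕏 ∧
        ∀ ε : I, 0 < ε → ∀ᵐ W ∂(𝕎 : Measure (AdditiveSDE.PathSpace d)),
          (AdditiveSDE.condLawUpTo 𝕏 ε W).support.Nontrivial) ∧
      (AdditiveSDE.WeakUniqueness u y 𝕎 → ∀ ε : I, 0 < ε →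
        ∃ 𝕐 : ProbabilityMeasure
            (AdditiveSDE.PathSpace d × AdditiveSDE.PathSpace d × AdditiveSDE.PathSpace d),
          AdditiveSDE.IsWeakCoupling u y 𝕎 𝕐 ∧
          (𝕐 : Measure (AdditiveSDE.PathSpace d × AdditiveSDE.PathSpace d ×
            AdditiveSDE.PathSpace d)) (AdditiveSDE.coincidence d ε) = 0)) ∧
    ∀ᵐ q ∂((𝕌 : Measure (AdditiveSDE.VelocityField d)).prod
        (𝕎 : Measure (AdditiveSDE.PathSpace d))),
      ∀ ε : I, 0 < ε → ∃ X₁ X₂ : AdditiveSDE.PathSpace d,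
        AdditiveSDE.IsCaratheodorySolution q.1 y q.2 X₁ ∧
        AdditiveSDE.IsCaratheodorySolution q.1 y q.2 X₂ ∧
        AdditiveSDE.restr ε X₁ ≠ AdditiveSDE.restr ε X₂ := by
  have hall := AdditiveSDE.ae_exists_coupling_coincidence_le hd h𝕎 hTpos hT hsep y
  refine ⟨?_, AdditiveSDE.ae_exists_two_solutions hd hTpos hT hsep y⟩
  filter_upwards [hall] with u hu
  have hone : ∀ ε : I, 0 < ε → ∀ γ : ℝ≥0∞, 0 < γ →
        ∃ 𝕐 : ProbabilityMeasure
            (AdditiveSDE.PathSpace d × AdditiveSDE.PathSpace d × AdditiveSDE.PathSpace d),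
          AdditiveSDE.IsWeakCoupling u y 𝕎 𝕐 ∧
          (𝕐 : Measure (AdditiveSDE.PathSpace d × AdditiveSDE.PathSpace d ×
            AdditiveSDE.PathSpace d)) (AdditiveSDE.coincidence d ε) ≤ γ := by
    intro ε hε γ hγ
    obtain ⟨𝕐, h1, h2, h3⟩ := hu ε hε γ hγ
    exact ⟨𝕐, ⟨h1.isWeakSolution, h2.isWeakSolution⟩, h3⟩
  obtain ⟨𝕏, h𝕏, h𝕏s⟩ := AdditiveSDE.exists_solution_support_nontrivial hu
  refine ⟨AdditiveSDE.not_pathwiseUniqueness (hone 1 one_pos (1 / 2) (by simp)), hone,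
    ⟨𝕏, h𝕏.isWeakSolution, h𝕏s⟩, fun huniq ε hε => ?_⟩
  exact AdditiveSDE.exists_coupling_coincidence_eq_zero h𝕏.isWeakSolution huniq ε (hone ε hε)
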